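/- Let $0\le N\le n$ be integers, let $H\in\mathbb R^{n\times n}$ be symmetric, and let $\eta,\lambda,r>0$. Put $$\mathcal C=\{P\in\mathbb R^{n\times n}: P=P^{\mathrm T},\ \operatorname{tr}P=N,\ 0\preceq P\preceq I\},\qquad \|P\|_1=\sum_{i,j}|P_{ij}|,$$ $$\operatorname{Shrink}(x,t)=\operatorname{sign}(x)\max\{|x|-t,0\}\ \text{ (applied entrywise to matrices)}.$$ For a real function $f$ and a symmetric matrix $A=V\operatorname{diag}(a_1,\dots,a_n)V^{\mathrm T}$ with $V$ orthogonal, let $f(A)=V\operatorname{diag}(f(a_1),\dots,f(a_n))V^{\mathrm T}$, and let $\operatorname{clip}(x)=\min\{\max\{x,0\},1\}$. Let $Q^0,R^0,B^0,D^0\in\mathbb R^{n\times n}$ be arbitrary symmetric matrices (for instance $Q^0=R^0=P^0\in\mathcal C$ and $B^0=D^0=0$). 1. (Zero temperature.) For $k\ge1$ let $$\Gamma^k=\tfrac{\lambda}{\lambda+r}(Q^{k-1}-B^{k-1})+\tfrac{r}{\lambda+r}(R^{k-1}-D^{k-1})-\tfrac1{\lambda+r}H,\qquad P^k=\Gamma^k-\tfrac{\operatorname{tr}\Gamma^k-N}{n}I,$$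 $$Q^k=\operatorname{Shrink}\bigl(P^k+B^{k-1},\tfrac1{\lambda\eta}\bigr),\qquad R^k=\operatorname{clip}(P^k+D^{k-1}),$$ $$B^k=B^{k-1}+P^k-Q^k,\qquad D^k=D^{k-1}+P^k-R^k .$$ Then there is a minimizer $P^*$ of $\operatorname{tr}(HP)+\frac1\eta\|P\|_1$ over $P\in\mathcal C$ such that $(P^k,Q^k,R^k)\to(P^*,P^*,P^*)$. 2. (Finite temperature.) Let $\beta>0$ and let $Z^{k,0}$ $(k\ge1)$ be arbitrary symmetric matrices. For $k\ge1$ let $$Z^{k,l}=\bigl[1+\exp(\beta Y^{k,l})\bigr]^{-1},\quad Y^{k,l}=H+\lambda(Z^{k,l-1}-Q^{k-1}+B^{k-1})+r(Z^{k,l-1}-R^{k-1}+D^{k-1})\quad(l\ge1),$$ let $P^k=\lim_{l\to\infty}Z^{k,l}$, put $M^k=P^k+B^{k-1}$, let $Q^k$ have the off-diagonal entries $Q^k_{ij}=\operatorname{Shrink}(M^k_{ij},\frac1{\lambda\eta})$ $(i\ne j)$ and a diagonal that minimizes $$q\mapsto\tfrac1\eta\sum_i|q_i|+\tfrac\lambda2\sum_i(q_i-M^k_{ii})^2\quad\text{over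 } q\in\mathbb R^n,\ \sum_iq_i=N,$$ and let $R^k=\operatorname{clip}(P^k+D^{k-1})$, $B^k=B^{k-1}+P^k-Q^k$, $D^k=D^{k-1}+P^k-R^k$. If $\beta(\lambda+r)<4$, such a sequence exists (in particular all the inner limits exist). Moreover, for every $\beta>0$ and every sequence generated in this way (with all inner limits existing), there is a minimizer $P^*$ of $$\operatorname{tr}(HP)+\tfrac1\beta\operatorname{tr}\{P\ln P+(1-P)\ln(1-P)\}+\tfrac1\eta\|P\|_1\quad\text{over }P\in\mathcal C$$ (with $0\ln0=0$) such that $(P^k,Q^k,R^k)\to(P^*,P^*,P^*)$. -/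

import Mathlib

open Filter Topology

noncomputable section

namespace LDM

/-- The set of admissible density matrices: real symmetric `n × n` matrices with
`tr P = N` and `0 ⪯ P ⪯ I`. -/
def feasible (n N : ℕ) : Set (Matrix (Fin n) (Fin n) ℝ) :=
  {P | P.IsSymm ∧ P.trace = (N : ℝ) ∧ P.PosSemidef ∧ (1 - P).PosSemidef}

/-- The entrywise `ℓ¹` norm of a matrix. -/
def entrywiseL1 {n : ℕ} (P : Matrix (Fin n) (Fin n) ℝ) : ℝ :=
  ∑ i, ∑ j, |P i j|

/-- The Fermi-Dirac entropy density `x ln x + (1 - x) ln (1 - x)`; since `Real.log 0 = 0`,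
the convention `0 ln 0 = 0` holds at the two endpoints of `[0, 1]`. -/
def entropy (x : ℝ) : ℝ := x * Real.log x + (1 - x) * Real.log (1 - x)

/-- Zero temperature energy `tr (H P) + η⁻¹ ‖P‖₁`. -/
def energyZeroTemp {n : ℕ} (H : Matrix (Fin n) (Fin n) ℝ) (η : ℝ)
    (P : Matrix (Fin n) (Fin n) ℝ) : ℝ :=
  (H * P).trace + 1 / η * entrywiseL1 P

/-- Finite temperature energy
`tr (H P) + β⁻¹ tr (P ln P + (1 - P) ln (1 - P)) + η⁻¹ ‖P‖₁`.
The function of the symmetric matrix `P` is taken in the spectral calculus. -/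
def energyFiniteTemp {n : ℕ} (H : Matrix (Fin n) (Fin n) ℝ) (β η : ℝ)
    (P : Matrix (Fin n) (Fin n) ℝ) : ℝ :=
  (H * P).trace + 1 / β * (cfc entropy P).trace + 1 / η * entrywiseL1 P

/-- `P` solves the zero temperature localized density matrix problem. -/
def IsZeroTempMinimizer {n : ℕ} (H : Matrix (Fin n) (Fin n) ℝ) (N : ℕ) (η : ℝ)
    (P : Matrix (Fin n) (Fin n) ℝ) : Prop :=
  P ∈ feasible n N ∧ IsMinOn (energyZeroTemp H η) (feasible n N) P

/-- `P` solves the finite temperature localized density matrix problem. -/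
def IsFiniteTempMinimizer {n : ℕ} (H : Matrix (Fin n) (Fin n) ℝ) (N : ℕ) (β η : ℝ)
    (P : Matrix (Fin n) (Fin n) ℝ) : Prop :=
  P ∈ feasible n N ∧ IsMinOn (energyFiniteTemp H β η) (feasible n N) P

/-- Scalar soft thresholding `sign x * max (|x| - t) 0`. -/
def shrink (x t : ℝ) : ℝ := Real.sign x * max (|x| - t) 0

/-- Eigenvalue clipping `V min{max{Λ, 0}, 1} Vᵀ` of a symmetric matrix `V Λ Vᵀ`. -/
def clipEig {n : ℕ} (A : Matrix (Fin n) (Fin n) ℝ) : Matrix (Fin n) (Fin n) ℝ :=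
  cfc (fun x : ℝ => min (max x 0) 1) A

/-- The Fermi-Dirac matrix function `[1 + exp (β Y)]⁻¹` of a symmetric matrix `Y`. -/
def fermiDirac {n : ℕ} (β : ℝ) (Y : Matrix (Fin n) (Fin n) ℝ) : Matrix (Fin n) (Fin n) ℝ :=
  cfc (fun x : ℝ => 1 / (1 + Real.exp (β * x))) Y

/-- The variables `(P, Q, R, B, D)` carried by the iterations. -/
structure State (n : ℕ) where
  P : Matrix (Fin n) (Fin n) ℝ
  Q : Matrix (Fin n) (Fin n) ℝ
  R : Matrix (Fin n) (Fin n) ℝ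
  B : Matrix (Fin n) (Fin n) ℝ
  D : Matrix (Fin n) (Fin n) ℝ

/-- The variables that the next iteration reads are symmetric matrices
(the `P` component is never read). -/
def State.IsSymm {n : ℕ} (s : State n) : Prop :=
  s.Q.IsSymm ∧ s.R.IsSymm ∧ s.B.IsSymm ∧ s.D.IsSymm

/-! ### Zero temperature iteration -/

/-- `P = Γ - ((tr Γ - N) / n) I`, where
`Γ = λ/(λ+r) (Q - B) + r/(λ+r) (R - D) - 1/(λ+r) H`. -/
def zeroTempP {n : ℕ} (H : Matrix (Fin n) (Fin n) ℝ) (N : ℕ) (lam r : ℝ) (s : State n) :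
    Matrix (Fin n) (Fin n) ℝ :=
  let Γ : Matrix (Fin n) (Fin n) ℝ :=
    (lam / (lam + r)) • (s.Q - s.B) + (r / (lam + r)) • (s.R - s.D) - (1 / (lam + r)) • H
  Γ - ((Γ.trace - (N : ℝ)) / (n : ℝ)) • (1 : Matrix (Fin n) (Fin n) ℝ)

/-- One pass of the zero temperature algorithm. -/
def zeroTempStep {n : ℕ} (H : Matrix (Fin n) (Fin n) ℝ) (N : ℕ) (η lam r : ℝ) (s : State n) :
    State n :=
  let P := zeroTempP H N lam r s
  let Q : Matrix (Fin n) (Fin n) ℝ := (P + s.B).map (fun x => shrink x (1 / (lam * η)))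
  let R := clipEig (P + s.D)
  { P := P, Q := Q, R := R, B := s.B + P - Q, D := s.D + P - R }

/-! ### Finite temperature iteration -/

/-- The inner iteration: `Z⁰ = Z₀` and `Zˡ⁺¹ = [1 + exp (β Yˡ⁺¹)]⁻¹` with
`Yˡ⁺¹ = H + λ (Zˡ - Q + B) + r (Zˡ - R + D)`. -/
def innerIter {n : ℕ} (H : Matrix (Fin n) (Fin n) ℝ) (β lam r : ℝ) (s : State n)
    (Z₀ : Matrix (Fin n) (Fin n) ℝ) : ℕ → Matrix (Fin n) (Fin n) ℝ
  | 0 => Z₀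
  | l + 1 =>
    fermiDirac β (H + lam • (innerIter H β lam r s Z₀ l - s.Q + s.B)
      + r • (innerIter H β lam r s Z₀ l - s.R + s.D))

/-- `q` is the minimizer of `η⁻¹ ‖q‖₁ + (λ/2) ‖q - m‖²` over vectors with `1ᵀ q = N`. -/
def IsDiagUpdate {n : ℕ} (N : ℕ) (η lam : ℝ) (m q : Fin n → ℝ) : Prop :=
  q ∈ {v : Fin n → ℝ | ∑ i, v i = (N : ℝ)} ∧
    IsMinOn (fun v : Fin n → ℝ => 1 / η * ∑ i, |v i| + lam / 2 * ∑ i, (v i - m i) ^ 2)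
      {v : Fin n → ℝ | ∑ i, v i = (N : ℝ)} q

/-- One pass `s ↦ s'` of the finite temperature algorithm, with inner starting point `Z₀`
and the inner loop run to convergence. -/
structure IsFiniteTempStep {n : ℕ} (H : Matrix (Fin n) (Fin n) ℝ) (N : ℕ) (β η lam r : ℝ)
    (Z₀ : Matrix (Fin n) (Fin n) ℝ) (s s' : State n) : Prop where
  P_eq : Tendsto (innerIter H β lam r s Z₀) atTop (𝓝 s'.P)
  Q_offDiag : ∀ i j, i ≠ j → s'.Q i j = shrink ((s'.P + s.B) i j) (lam * η)⁻¹
  Q_diag : IsDiagUpdate N η lam (s'.P + s.B).diag s'.Q.diag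
  R_eq : s'.R = clipEig (s'.P + s.D)
  B_eq : s'.B = s.B + s'.P - s'.Q
  D_eq : s'.D = s.D + s'.P - s'.R

/-- The sequence `s` is generated by the finite temperature algorithm, the inner loop of the
`(k+1)`-st pass being started at `Z₀ k`. -/
def IsFiniteTempRun {n : ℕ} (H : Matrix (Fin n) (Fin n) ℝ) (N : ℕ) (β η lam r : ℝ)
    (Z₀ : ℕ → Matrix (Fin n) (Fin n) ℝ) (s : ℕ → State n) : Prop :=
  ∀ k, IsFiniteTempStep H N β η lam r (Z₀ k) (s k) (s (k + 1))

/-- The triples `(Pᵏ, Qᵏ, Rᵏ)` converge to `(P, P, P)`. -/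
def ConvergesTo {n : ℕ} (s : ℕ → State n) (P : Matrix (Fin n) (Fin n) ℝ) : Prop :=
  Tendsto (fun k => ((s k).P, (s k).Q, (s k).R)) atTop (𝓝 (P, P, P))

end LDM

end

/-! ### Douglas-Rachford splitting -/

section DouglasRachford

namespace LDM

open scoped RealInnerProductSpace

variable {E : Type*} [NormedAddCommGroup E]

/-! Both algorithms are the alternating direction method for f(P) + η⁻¹‖Q‖₁ under the constraint (P,
P) = (Q, R), with P ∈ DP, Q ∈ DQ and 0 ⪯ R ⪯ I; the trace constraint belongs to DP at zero
temperature and to DQ at finite temperature. On pairs of symmetric matrices with inner product λ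
tr(AA') + r tr(BB'), the variable z = (Q + B, R + D) moves by the Douglas-Rachford operator of the
two proximal maps. This operator is firmly nonexpansive (`isFirm_drMap`), so in finite dimension a
single fixed point makes every orbit converge, and the proximal point of the limit is a minimizer.

The difficulty is the fixed point. For every s > 0 there is a resolvent point with T z - z = s z,
and `energy_le_of_displacement` controls its energy. If 0 < N < n, then (N/n) I is a Slater point;
it bounds the resolvent points uniformly, and they accumulate at a fixed point as s → 0
(`exists_drMap_fixed`). If N = 0 or N = n there is no Slater point, and at finite temperature with n
> 0 no fixed point: Fermi-Dirac matrices have spectrum strictly inside (0, 1). But then only (N/n) I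
is feasible. The resolvent points still are approximate fixed points, which makes the displacements
tend to 0 (`drMap_asymptotically_regular`); hence tr R → N, and this together with 0 ⪯ R ⪯ I forces
R → (N/n) I, and P and Q follow.

Matrix inequalities reduce to scalar ones through `exists_trace_weights`. The finite temperature
P-update solves a self-consistent equation. It has a solution for every β because the Fermi-Dirac
function is decreasing; the inner loop is a contraction when β(λ + r) < 4 because the sigmoid is
1/4-Lipschitz. -/

theorem continuous_of_norm_sub_le {J : E → E} (h : ∀ x y, ‖J x - J y‖ ≤ ‖x - y‖) :
    Continuous J := by
  refine (LipschitzWith.of_dist_le_mul (K := 1) fun x y => ?_).continuous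
  simpa [dist_eq_norm] using h x y

theorem exists_fixed_of_contraction [CompleteSpace E] {Φ : E → E} {c : ℝ} (hc₀ : 0 ≤ c)
    (hc₁ : c < 1) (h : ∀ x y, ‖Φ x - Φ y‖ ≤ c * ‖x - y‖) :
    ∃ z, Φ z = z ∧ ∀ x, Tendsto (fun k => Φ^[k] x) atTop (𝓝 z) := by
  lift c to NNReal using hc₀
  have hc : ContractingWith c Φ := ⟨by exact_mod_cast hc₁, LipschitzWith.of_dist_le_mul fun x y => by
    rw [dist_eq_norm, dist_eq_norm]; exact h x y⟩
  exact ⟨hc.fixedPoint, hc.fixedPoint_isFixedPt, hc.tendsto_iterate_fixedPoint⟩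

/-- Firm nonexpansiveness. -/
def IsFirm (T : E → E) : Prop :=
  ∀ x y, ‖T x - T y‖ ^ 2 + ‖(T x - x) - (T y - y)‖ ^ 2 ≤ ‖x - y‖ ^ 2

theorem IsFirm.norm_sub_le {T : E → E} (h : IsFirm T) (x y : E) : ‖T x - T y‖ ≤ ‖x - y‖ := by
  refine le_of_sq_le_sq ?_ (norm_nonneg _)
  nlinarith [h x y, sq_nonneg ‖(T x - x) - (T y - y)‖]

theorem IsFirm.iterate_norm_sub_le {T : E → E} (h : IsFirm T) (x y : E) (k : ℕ) :
    ‖T^[k] x - T^[k] y‖ ≤ ‖x - y‖ := by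
  induction k with
  | zero => simp
  | succ k ih =>
    simp only [Function.iterate_succ_apply']
    exact (h.norm_sub_le _ _).trans ih

/-- The displacements along two orbits of a firmly nonexpansive map become equal. -/
theorem IsFirm.tendsto_displacement_sub {T : E → E} (h : IsFirm T) (x y : E) :
    Tendsto (fun k => (T^[k + 1] x - T^[k] x) - (T^[k + 1] y - T^[k] y)) atTop (𝓝 0) := by
  set a : ℕ → ℝ := fun k => ‖T^[k] x - T^[k] y‖ ^ 2
  -- Firmness bounds the squared difference of displacements by a telescoping decrement of a
  -- convergent sequence.
  have hstep : ∀ k, ‖(T^[k + 1] x - T^[k] x) - (T^[k + 1] y - T^[k] y)‖ ^ 2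
      ≤ a k - a (k + 1) := by
    intro k
    have := h (T^[k] x) (T^[k] y)
    simp only [a, Function.iterate_succ_apply']
    linarith
  have hanti : Antitone a := antitone_nat_of_succ_le fun k => by
    nlinarith [hstep k, sq_nonneg ‖(T^[k + 1] x - T^[k] x) - (T^[k + 1] y - T^[k] y)‖]
  have hlim := tendsto_atTop_ciInf hanti ⟨0, by rintro _ ⟨k, rfl⟩; positivity⟩
  have hdiff : Tendsto (fun k => a k - a (k + 1)) atTop (𝓝 0) := by
    simpa using hlim.sub (hlim.comp (tendsto_add_atTop_nat 1))
  have hsq := squeeze_zero (fun k => sq_nonneg _) hstep hdiff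
  have := hsq.sqrt
  simp only [Real.sqrt_sq (norm_nonneg _), Real.sqrt_zero] at this
  exact tendsto_zero_iff_norm_tendsto_zero.2 this

theorem IsFirm.displacement_le {T : E → E} (h : IsFirm T) (y : E) (k : ℕ) :
    ‖T^[k + 1] y - T^[k] y‖ ≤ ‖T y - y‖ := by
  have := h.iterate_norm_sub_le (T y) y k
  rwa [← Function.iterate_succ_apply] at this

/-- A firmly nonexpansive map with approximate fixed points is asymptotically regular. -/
theorem IsFirm.asymptotically_regular {T : E → E} (h : IsFirm T)
    (happ : ∀ ε > 0, ∃ y, ‖T y - y‖ < ε) (x : E) :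
    Tendsto (fun k => T^[k + 1] x - T^[k] x) atTop (𝓝 0) := by
  rw [Metric.tendsto_atTop]
  intro ε hε
  obtain ⟨y, hy⟩ := happ (ε / 2) (by positivity)
  obtain ⟨K, hK⟩ := Metric.tendsto_atTop.1 (h.tendsto_displacement_sub x y) (ε / 2)
    (by positivity)
  refine ⟨K, fun k hk => ?_⟩
  have h1 := hK k hk
  have h2 := h.displacement_le y k
  rw [dist_zero_right] at h1 ⊢
  have h3 := norm_add_le ((T^[k + 1] x - T^[k] x) - (T^[k + 1] y - T^[k] y))
    (T^[k + 1] y - T^[k] y)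
  rw [sub_add_cancel] at h3
  linarith

/-! ### Proximal maps and the Douglas-Rachford operator -/

variable [InnerProductSpace ℝ E]

/-- `J` is the proximal map of the function `F` with domain `D`, expressed by the variational
inequality `w - J w ∈ ∂F (J w)`. -/
structure IsProx (D : Set E) (F : E → ℝ) (J : E → E) : Prop where
  mem : ∀ w, J w ∈ D
  le : ∀ w, ∀ x ∈ D, F (J w) + ⟪w - J w, x - J w⟫ ≤ F x

/-- Each variational inequality is tested at the proximal point of the other argument; the values of
`F` cancel in the sum. -/
theorem IsProx.firm {D : Set E} {F : E → ℝ} {J : E → E} (h : IsProx D F J) (x y : E) :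
    ‖J x - J y‖ ^ 2 ≤ ⟪x - y, J x - J y⟫ := by
  have h1 := h.le x (J y) (h.mem y)
  have h2 := h.le y (J x) (h.mem x)
  rw [← real_inner_self_eq_norm_sq]
  simp only [inner_sub_left, inner_sub_right] at *
  linarith [real_inner_comm (J x) (J y)]

theorem IsProx.eq_of_le {D : Set E} {F : E → ℝ} {J : E → E} (h : IsProx D F J) {w q : E}
    (hq : q ∈ D) (hle : ∀ x ∈ D, F q + ⟪w - q, x - q⟫ ≤ F x) : q = J w := by
  have h1 := h.le w q hq
  have h2 := hle (J w) (h.mem w)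
  have h3 : ‖q - J w‖ ^ 2 ≤ 0 := by
    rw [← real_inner_self_eq_norm_sq]
    simp only [inner_sub_left, inner_sub_right] at *
    linarith [real_inner_comm q (J w)]
  have h4 : ‖q - J w‖ = 0 := by nlinarith [norm_nonneg (q - J w)]
  exact sub_eq_zero.1 (norm_eq_zero.1 h4)

theorem IsProx.norm_sub_le {D : Set E} {F : E → ℝ} {J : E → E} (h : IsProx D F J) (x y : E) :
    ‖J x - J y‖ ≤ ‖x - y‖ := by
  have h1 := h.firm x y
  have h2 := real_inner_le_norm (x - y) (J x - J y)
  by_contra! hlt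
  nlinarith [norm_nonneg (x - y), norm_nonneg (J x - J y)]

/-- The Douglas-Rachford operator. -/
def drMap (JF JG : E → E) (z : E) : E := z + JF ((2 : ℝ) • JG z - z) - JG z

/-- With d = x - y and p, q the increments of `JG` and `JF`, the claim reduces to ‖q - p‖² + ⟪d, q -
p⟫ ≤ 0. This is the sum of ‖p‖² ≤ ⟪d, p⟫ and ‖q‖² ≤ ⟪2p - d, q⟫. -/
theorem isFirm_drMap {DF DG : Set E} {F G : E → ℝ} {JF JG : E → E} (hF : IsProx DF F JF)
    (hG : IsProx DG G JG) : IsFirm (drMap JF JG) := by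
  intro x y
  have h1 := hG.firm x y
  have h2 := hF.firm ((2 : ℝ) • JG x - x) ((2 : ℝ) • JG y - y)
  set p := JG x - JG y with hp
  set q := JF ((2 : ℝ) • JG x - x) - JF ((2 : ℝ) • JG y - y) with hq
  have e1 : (2 : ℝ) • JG x - x - ((2 : ℝ) • JG y - y) = (2 : ℝ) • p - (x - y) := by
    rw [hp]; module
  have e2 : drMap JF JG x - drMap JF JG y = (x - y) + (q - p) := by
    simp only [drMap, hp, hq]; module
  have e3 : (drMap JF JG x - x) - (drMap JF JG y - y) = q - p := by
    simp only [drMap, hp, hq]; module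
  rw [e1] at h2
  rw [e2, e3]
  generalize x - y = d at *
  simp only [← real_inner_self_eq_norm_sq, inner_sub_left, inner_sub_right, inner_add_left,
    inner_add_right, real_inner_smul_left] at *
  linarith [real_inner_comm p q, real_inner_comm d q, real_inner_comm d p]

/-- The orbits of a firmly nonexpansive map with a fixed point converge to fixed points. -/
theorem IsFirm.exists_tendsto [FiniteDimensional ℝ E] {T : E → E} (h : IsFirm T) {y : E}
    (hy : T y = y) (x : E) : ∃ z, T z = z ∧ Tendsto (fun k => T^[k] x) atTop (𝓝 z) := by
  have hfix : ∀ {z}, T z = z → ∀ k, T^[k] z = z := fun hz k => Function.iterate_fixed hz k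
  have hcont : Continuous T := continuous_of_norm_sub_le h.norm_sub_le
  have hreg := h.asymptotically_regular (fun ε hε => ⟨y, by simpa [hy] using hε⟩) x
  obtain ⟨z, -, φ, hφ, hz⟩ := (isCompact_closedBall y ‖x - y‖).tendsto_subseq
    (x := fun k => T^[k] x) (fun k => by
      have := h.iterate_norm_sub_le x y k
      rwa [hfix hy, ← dist_eq_norm] at this)
  have hTz : T z = z := by
    have h1 : Tendsto (fun k => T (T^[φ k] x) - T^[φ k] x) atTop (𝓝 (T z - z)) :=
      ((hcont.tendsto z).comp hz).sub hz
    have h2 : Tendsto (fun k => T (T^[φ k] x) - T^[φ k] x) atTop (𝓝 0) := by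
      have := hreg.comp hφ.tendsto_atTop
      simpa only [Function.comp_def, Function.iterate_succ_apply'] using this
    exact sub_eq_zero.1 (tendsto_nhds_unique h1 h2)
  refine ⟨z, hTz, ?_⟩
  -- The distance to the cluster point, now known to be fixed, is nonincreasing, so convergence
  -- along a subsequence is convergence.
  have hanti : Antitone fun k => ‖T^[k] x - z‖ := antitone_nat_of_succ_le fun k => by
    have := h.norm_sub_le (T^[k] x) z
    simpa only [hTz, Function.iterate_succ_apply'] using this
  rw [tendsto_iff_norm_sub_tendsto_zero]
  have hlim := tendsto_atTop_ciInf hanti ⟨0, by rintro _ ⟨k, rfl⟩; positivity⟩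
  have h1 := hlim.comp hφ.tendsto_atTop
  have h2 := tendsto_iff_norm_sub_tendsto_zero.1 hz
  rwa [tendsto_nhds_unique h1 h2] at hlim

/-- Resolvent points of a nonexpansive map. -/
theorem IsFirm.exists_displacement_eq_smul [CompleteSpace E] {T : E → E} (h : IsFirm T) {s : ℝ}
    (hs : 0 < s) : ∃ z, T z - z = s • z := by
  obtain ⟨z, hz, -⟩ := exists_fixed_of_contraction (Φ := fun z => (1 + s)⁻¹ • T z)
    (c := (1 + s)⁻¹) (by positivity) (inv_lt_one_of_one_lt₀ (by linarith)) fun x y => by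
      rw [← smul_sub, norm_smul, Real.norm_of_nonneg (by positivity)]
      exact mul_le_mul_of_nonneg_left (h.norm_sub_le x y) (by positivity)
  refine ⟨z, ?_⟩
  have hT : T z = (1 + s) • z := by
    conv_rhs => rw [← hz]
    rw [smul_inv_smul₀ (by positivity)]
  rw [hT]
  module

/-! ### Fixed points and convergence of the Douglas-Rachford operator -/

section Splitting

variable {DF DG : Set E} {F G : E → ℝ} {JF JG : E → E}

theorem drMap_sub_self (z : E) :
    drMap JF JG z - z = JF ((2 : ℝ) • JG z - z) - JG z := by
  simp only [drMap]; abel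

/-- Energy estimate at a resolvent point of the Douglas-Rachford operator. -/
theorem energy_le_of_displacement (hF : IsProx DF F JF) (hG : IsProx DG G JG) {s : ℝ} {z : E}
    (hz : drMap JF JG z - z = s • z) {xF xG : E} (hxF : xF ∈ DF) (hxG : xG ∈ DG) :
    F (JF ((2 : ℝ) • JG z - z)) + G (JG z) + ⟪z - JG z, xG - xF⟫
      + s * ‖z‖ ^ 2 + s ^ 2 * ‖z‖ ^ 2 - s * ⟪z, xF⟫ ≤ F xF + G xG := by
  have h1 := hG.le z xG hxG
  have h2 := hF.le ((2 : ℝ) • JG z - z) xF hxF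
  rw [drMap_sub_self] at hz
  have hq : JF ((2 : ℝ) • JG z - z) = JG z + s • z := by rw [← hz]; abel
  rw [hq] at h2 ⊢
  generalize JG z = p at *
  simp only [← real_inner_self_eq_norm_sq, inner_sub_left, inner_sub_right, inner_add_left,
    inner_add_right, real_inner_smul_left, real_inner_smul_right] at *
  rw [real_inner_comm z p] at *
  linarith

/-- The energies of a splitting grow at least like the distance of their arguments. -/
def EnergyBoundedBelow (DF DG : Set E) (F G : E → ℝ) (C : ℝ) : Prop :=
  0 ≤ C ∧ ∀ q ∈ DF, ∀ p ∈ DG, -C - C * ‖q - p‖ ≤ F q + G p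

theorem exists_drMap_approx_fixed [CompleteSpace E] (hF : IsProx DF F JF) (hG : IsProx DG G JG)
    {C : ℝ} (hC : EnergyBoundedBelow DF DG F G C) {x : E} (hxF : x ∈ DF) (hxG : x ∈ DG) :
    ∀ ε > 0, ∃ y, ‖drMap JF JG y - y‖ < ε := by
  intro ε hε
  set A : ℝ := 2 * |F x + G x + C| + (C + ‖x‖) ^ 2 with hA
  have hA0 : 0 ≤ A := by positivity
  set s : ℝ := min 1 (ε ^ 2 / (2 * (A + 1))) with hs
  have hs0 : 0 < s := by positivity
  have hs1 : s ≤ 1 := min_le_left _ _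
  have hs2 : s * (2 * (A + 1)) ≤ ε ^ 2 := by
    rw [← le_div_iff₀ (by positivity)]; exact min_le_right _ _
  obtain ⟨z, hz⟩ := (isFirm_drMap hF hG).exists_displacement_eq_smul hs0
  refine ⟨z, ?_⟩
  have h1 := energy_le_of_displacement hF hG hz hxF hxG
  have h2 := hC.2 _ (hF.mem ((2 : ℝ) • JG z - z)) _ (hG.mem z)
  rw [← drMap_sub_self, hz, norm_smul, Real.norm_of_nonneg hs0.le] at h2
  rw [hz, norm_smul, Real.norm_of_nonneg hs0.le]
  simp only [sub_self, inner_zero_right, add_zero] at h1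
  have h3 := real_inner_le_norm z x
  have h4 : s * ⟪z, x⟫ ≤ s * (‖z‖ * ‖x‖) := by gcongr
  have h5 := le_abs_self (F x + G x + C)
  have h6 : 0 ≤ s * (‖z‖ - (C + ‖x‖)) ^ 2 := by positivity
  have h7 : s * (C + ‖x‖) ^ 2 ≤ 1 * (C + ‖x‖) ^ 2 := by gcongr
  -- The terms linear in ‖z‖ are absorbed into half of s‖z‖² by completing the square. Since s‖z‖²
  -- stays bounded, the displacement s‖z‖ is of order √s.
  have h8 : s * ‖z‖ ^ 2 ≤ A := by nlinarith [sq_nonneg (s * ‖z‖)]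
  refine lt_of_pow_lt_pow_left₀ 2 hε.le ?_
  have h9 : s * (s * ‖z‖ ^ 2) ≤ s * A := by gcongr
  nlinarith

theorem drMap_asymptotically_regular [CompleteSpace E] (hF : IsProx DF F JF)
    (hG : IsProx DG G JG) {C : ℝ} (hC : EnergyBoundedBelow DF DG F G C) {x : E} (hxF : x ∈ DF)
    (hxG : x ∈ DG) (z : ℕ → E) (hz : ∀ k, z (k + 1) = drMap JF JG (z k)) :
    Tendsto (fun k => JF ((2 : ℝ) • JG (z k) - z k) - JG (z k)) atTop (𝓝 0) := by
  have hk : ∀ k, z k = (drMap JF JG)^[k] (z 0) := by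
    intro k
    induction k with
    | zero => rfl
    | succ k ih => rw [Function.iterate_succ_apply', ← ih, hz]
  have := (isFirm_drMap hF hG).asymptotically_regular
    (exists_drMap_approx_fixed hF hG hC hxF hxG) (z 0)
  refine this.congr fun k => ?_
  rw [← drMap_sub_self, ← hz, hk (k + 1), hk k]

/-- Qualification condition: a ball around the origin consists of differences of points of the
two domains at which the energies stay bounded, and `DG` is bounded up to the distance to `DF`. -/
structure IsQualified (DF DG : Set E) (F G : E → ℝ) (ρ C : ℝ) : Prop where
  pos : 0 < ρ
  nonneg : 0 ≤ C
  exists_sub : ∀ w, ‖w‖ ≤ ρ → ∃ xF ∈ DF, ∃ xG ∈ DG, xG - xF = w ∧ ‖xF‖ ≤ C ∧ F xF + G xG ≤ C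
  norm_le : ∀ q ∈ DF, ∀ p ∈ DG, ‖p‖ ≤ C + C * ‖q - p‖

theorem exists_drMap_fixed [FiniteDimensional ℝ E] (hF : IsProx DF F JF) (hG : IsProx DG G JG)
    {C ρ : ℝ} (hC : EnergyBoundedBelow DF DG F G C) (hQ : IsQualified DF DG F G ρ C) :
    ∃ z, drMap JF JG z = z := by
  have : CompleteSpace E := FiniteDimensional.complete ℝ E
  have hρ := hQ.pos
  have hC0 := hQ.nonneg
  set K : ℝ := (2 * C + (2 * C) ^ 2) / ρ with hK
  set s : ℕ → ℝ := fun j => 1 / (2 * C + 1 + j) with hs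
  have hs0 : ∀ j, 0 < s j := fun j => by positivity
  have hs1 : ∀ j, s j ≤ 1 := fun j => by
    rw [hs]; simp only; rw [div_le_one (by positivity)]; linarith [Nat.cast_nonneg (α := ℝ) j]
  have hs2 : ∀ j, 2 * C * s j ≤ 1 := fun j => by
    rw [hs]; simp only; rw [mul_one_div, div_le_one (by positivity)]
    linarith [Nat.cast_nonneg (α := ℝ) j]
  choose z hz using fun j => (isFirm_drMap hF hG).exists_displacement_eq_smul (hs0 j)
  have hu : ∀ j, ‖z j - JG (z j)‖ ≤ K := by
    intro j
    by_cases h0 : z j - JG (z j) = 0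
    · rw [h0, norm_zero]; positivity
    have hn : 0 < ‖z j - JG (z j)‖ := norm_pos_iff.2 h0
    -- The Slater points are taken along the dual vector u = z - `JG` z itself, so that the pairing
    -- in the energy estimate becomes ρ‖u‖.
    obtain ⟨xF, hxF, xG, hxG, hw, hb, he⟩ := hQ.exists_sub
      ((ρ / ‖z j - JG (z j)‖) • (z j - JG (z j))) (by
        rw [norm_smul, Real.norm_of_nonneg (by positivity), div_mul_cancel₀ _ hn.ne'])
    have h1 := energy_le_of_displacement hF hG (hz j) hxF hxG
    have h2 := hC.2 _ (hF.mem ((2 : ℝ) • JG (z j) - z j)) _ (hG.mem (z j))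
    rw [← drMap_sub_self, hz j, norm_smul, Real.norm_of_nonneg (hs0 j).le] at h2
    rw [hw, real_inner_smul_right, real_inner_self_eq_norm_sq] at h1
    have e : ρ / ‖z j - JG (z j)‖ * ‖z j - JG (z j)‖ ^ 2 = ρ * ‖z j - JG (z j)‖ := by
      field_simp
    rw [e] at h1
    have h3 := real_inner_le_norm (z j) xF
    have h4 : s j * ⟪z j, xF⟫ ≤ s j * (‖z j‖ * C) :=
      mul_le_mul_of_nonneg_left (h3.trans (by gcongr)) (hs0 j).le
    have h6 : 0 ≤ s j * (‖z j‖ - C) ^ 2 := mul_nonneg (hs0 j).le (sq_nonneg _)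
    have h7 : s j * C ^ 2 ≤ 1 * C ^ 2 := by gcongr; exact hs1 j
    rw [hK, le_div_iff₀ hρ]
    nlinarith [sq_nonneg (s j * ‖z j‖)]
  have hbd : ∀ j, ‖z j‖ ≤ 2 * (C + K) := by
    intro j
    have h1 := hQ.norm_le _ (hF.mem ((2 : ℝ) • JG (z j) - z j)) _ (hG.mem (z j))
    rw [← drMap_sub_self, hz j, norm_smul, Real.norm_of_nonneg (hs0 j).le] at h1
    have h2 := norm_add_le (z j - JG (z j)) (JG (z j))
    rw [sub_add_cancel] at h2
    -- The bound on ‖`JG` z‖ contains C s‖z‖; since 2Cs ≤ 1, it is absorbed by half of ‖z‖.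
    have h3 := mul_le_mul_of_nonneg_right (hs2 j) (norm_nonneg (z j))
    linarith [hu j]
  obtain ⟨y, -, φ, hφ, hy⟩ := (isCompact_closedBall (0 : E) (2 * (C + K))).tendsto_subseq
    (x := z) (fun j => by simpa using hbd j)
  refine ⟨y, ?_⟩
  have hcont : Continuous (drMap JF JG) :=
    continuous_of_norm_sub_le (isFirm_drMap hF hG).norm_sub_le
  have hs' : Tendsto s atTop (𝓝 0) := by
    refine Tendsto.div_atTop tendsto_const_nhds ?_
    exact tendsto_atTop_add_const_left _ _ tendsto_natCast_atTop_atTop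
  have h1 : Tendsto (fun j => drMap JF JG (z (φ j)) - z (φ j)) atTop (𝓝 (drMap JF JG y - y)) :=
    ((hcont.tendsto y).comp hy).sub hy
  have h2 : Tendsto (fun j => drMap JF JG (z (φ j)) - z (φ j)) atTop (𝓝 ((0 : ℝ) • y)) := by
    simp only [hz]
    exact (hs'.comp hφ.tendsto_atTop).smul hy
  rw [zero_smul] at h2
  exact sub_eq_zero.1 (tendsto_nhds_unique h1 h2)

/-- Convergence of the Douglas-Rachford iteration under the qualification condition. -/
theorem exists_drMap_tendsto [FiniteDimensional ℝ E] (hF : IsProx DF F JF) (hG : IsProx DG G JG)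
    {C ρ : ℝ} (hC : EnergyBoundedBelow DF DG F G C) (hQ : IsQualified DF DG F G ρ C)
    (z : ℕ → E) (hz : ∀ k, z (k + 1) = drMap JF JG (z k)) :
    ∃ x ∈ DF, x ∈ DG ∧ (∀ y ∈ DF, y ∈ DG → F x + G x ≤ F y + G y) ∧
      Tendsto (fun k => JG (z k)) atTop (𝓝 x) ∧
      Tendsto (fun k => JF ((2 : ℝ) • JG (z k) - z k)) atTop (𝓝 x) := by
  obtain ⟨y, hy⟩ := exists_drMap_fixed hF hG hC hQ
  obtain ⟨w, hw, hlim⟩ := (isFirm_drMap hF hG).exists_tendsto hy (z 0)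
  have hk : ∀ k, z k = (drMap JF JG)^[k] (z 0) := by
    intro k
    induction k with
    | zero => rfl
    | succ k ih => rw [Function.iterate_succ_apply', ← ih, hz]
  simp only [← hk] at hlim
  have hcG : Continuous JG := continuous_of_norm_sub_le hG.norm_sub_le
  have hcF : Continuous JF := continuous_of_norm_sub_le hF.norm_sub_le
  have heq : JF ((2 : ℝ) • JG w - w) = JG w := by
    have := drMap_sub_self (JF := JF) (JG := JG) w
    rw [hw, sub_self] at this
    exact (sub_eq_zero.1 this.symm)
  have hG' : Tendsto (fun k => JG (z k)) atTop (𝓝 (JG w)) := (hcG.tendsto w).comp hlim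
  refine ⟨JG w, heq ▸ hF.mem _, hG.mem _, fun x hxF hxG => ?_, hG', ?_⟩
  -- At s = 0, with both test points equal, the energy estimate is optimality.
  · have h1 := energy_le_of_displacement hF hG (s := 0) (z := w) (by rw [hw]; simp) hxF hxG
    rw [heq] at h1
    simpa using h1
  · have := (hcF.tendsto ((2 : ℝ) • JG w - w)).comp ((hG'.const_smul (2 : ℝ)).sub hlim)
    rwa [heq] at this

end Splitting

/-- An antitone Lipschitz map of a Hilbert space has a fixed point. -/
theorem exists_fixed_of_antitone [CompleteSpace E] {Φ : E → E} {L : ℝ}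
    (hmono : ∀ x y, ⟪Φ x - Φ y, x - y⟫ ≤ 0)
    (hlip : ∀ x y, ‖Φ x - Φ y‖ ^ 2 ≤ L ^ 2 * ‖x - y‖ ^ 2) : ∃ z, Φ z = z := by
  -- Averaging with the identity gives a contraction, as the cross term is nonpositive; this θ
  -- minimizes (1 - θ)² + θ²L².
  set θ : ℝ := 1 / (1 + L ^ 2) with hθ
  have hθ0 : 0 < θ := by positivity
  have hθ1 : θ ≤ 1 := by
    rw [hθ, div_le_one (by positivity)]; nlinarith [sq_nonneg L]
  have hθ2 : (1 - θ) ^ 2 + θ ^ 2 * L ^ 2 = 1 - θ := by rw [hθ]; field_simp; ring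
  obtain ⟨z, hz, -⟩ := exists_fixed_of_contraction (Φ := fun z => (1 - θ) • z + θ • Φ z)
    (c := √(1 - θ)) (by positivity) (by rw [Real.sqrt_lt' one_pos]; linarith) fun x y => by
      refine le_of_sq_le_sq ?_ (by positivity)
      rw [mul_pow, Real.sq_sqrt (by linarith)]
      have e : (1 - θ) • x + θ • Φ x - ((1 - θ) • y + θ • Φ y)
          = (1 - θ) • (x - y) + θ • (Φ x - Φ y) := by module
      rw [e, norm_add_sq_real, norm_smul, norm_smul, real_inner_smul_left,
        real_inner_smul_right, mul_pow, mul_pow, Real.norm_eq_abs, Real.norm_eq_abs, sq_abs,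
        sq_abs, real_inner_comm]
      have h1 := mul_nonneg (mul_nonneg (sub_nonneg.2 hθ1) hθ0.le)
        (neg_nonneg.2 (hmono x y))
      have h2 := mul_le_mul_of_nonneg_left (hlip x y) (sq_nonneg θ)
      have h3 : ((1 - θ) ^ 2 + θ ^ 2 * L ^ 2) * ‖x - y‖ ^ 2 = (1 - θ) * ‖x - y‖ ^ 2 := by
        rw [hθ2]
      linarith
  refine ⟨z, ?_⟩
  have : θ • (Φ z - z) = 0 := by
    calc θ • (Φ z - z) = (1 - θ) • z + θ • Φ z - z := by module
      _ = 0 := sub_eq_zero.2 hz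
  exact sub_eq_zero.1 ((smul_eq_zero.1 this).resolve_left hθ0.ne')

end LDM

end DouglasRachford

/-! ### Trace inequalities for functions of symmetric matrices -/

section Spectral

namespace LDM

open Matrix

variable {n : ℕ} {A B X Y : Matrix (Fin n) (Fin n) ℝ}

theorem isHermitian_of_isSymm (hA : A.IsSymm) : A.IsHermitian := by
  rw [IsHermitian, conjTranspose_eq_transpose_of_trivial]; exact hA

theorem isSymm_of_isHermitian (hA : A.IsHermitian) : A.IsSymm := by
  rw [IsHermitian, conjTranspose_eq_transpose_of_trivial] at hA; exact hA

theorem isSymm_cfc (f : ℝ → ℝ) (A : Matrix (Fin n) (Fin n) ℝ) : (cfc f A).IsSymm :=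
  isSymm_of_isHermitian (cfc_predicate f A)

theorem cfc_eq_conj (hA : A.IsHermitian) (f : ℝ → ℝ) :
    cfc f A = (hA.eigenvectorUnitary : Matrix (Fin n) (Fin n) ℝ)
      * diagonal (f ∘ hA.eigenvalues) * (hA.eigenvectorUnitary : Matrix (Fin n) (Fin n) ℝ)ᴴ := by
  rw [hA.cfc_eq, IsHermitian.cfc, Unitary.conjStarAlgAut_apply]
  rfl

/-- The spectrum is finite, so the rules of the continuous functional calculus hold for every real
function. -/
theorem continuousOn_spectrum (f : ℝ → ℝ) (A : Matrix (Fin n) (Fin n) ℝ) :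
    ContinuousOn f (spectrum ℝ A) :=
  (Matrix.finite_real_spectrum (A := A)).continuousOn f

theorem cfc_mul_fun (f g : ℝ → ℝ) (A : Matrix (Fin n) (Fin n) ℝ) :
    cfc f A * cfc g A = cfc (fun x => f x * g x) A :=
  (cfc_mul f g A (continuousOn_spectrum f A) (continuousOn_spectrum g A)).symm

theorem cfc_sub_fun (f g : ℝ → ℝ) (A : Matrix (Fin n) (Fin n) ℝ) :
    cfc f A - cfc g A = cfc (fun x => f x - g x) A :=
  (cfc_sub f g A (continuousOn_spectrum f A) (continuousOn_spectrum g A)).symm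

theorem cfc_id_of_isSymm (hA : A.IsSymm) : cfc (fun x : ℝ => x) A = A :=
  cfc_id' ℝ A (isHermitian_of_isSymm hA)

theorem cfc_one_of_isSymm (hA : A.IsSymm) : cfc (fun _ : ℝ => (1 : ℝ)) A = 1 :=
  cfc_const_one ℝ A (isHermitian_of_isSymm hA)

/-- The trace of a product of functions of two symmetric matrices is a double sum over the
eigenvalues with nonnegative weights. -/
theorem exists_trace_weights (hA : A.IsHermitian) (hB : B.IsHermitian) :
    ∃ w : Fin n → Fin n → ℝ, (∀ i j, 0 ≤ w i j) ∧ ∀ f g : ℝ → ℝ,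
      (cfc f A * cfc g B).trace
        = ∑ i, ∑ j, w i j * (f (hA.eigenvalues i) * g (hB.eigenvalues j)) := by
  set U : Matrix (Fin n) (Fin n) ℝ := (hA.eigenvectorUnitary).1
  set V : Matrix (Fin n) (Fin n) ℝ := (hB.eigenvectorUnitary).1
  refine ⟨fun i j => ((Uᴴ * V) i j) ^ 2, fun i j => sq_nonneg _, fun f g => ?_⟩
  rw [cfc_eq_conj hA f, cfc_eq_conj hB g]
  change (U * diagonal (f ∘ hA.eigenvalues) * Uᴴ * (V * diagonal (g ∘ hB.eigenvalues) * Vᴴ)).trace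
    = _
  have e : (U * diagonal (f ∘ hA.eigenvalues) * Uᴴ
        * (V * diagonal (g ∘ hB.eigenvalues) * Vᴴ)).trace
      = (diagonal (f ∘ hA.eigenvalues) * (Uᴴ * V) * (diagonal (g ∘ hB.eigenvalues)
        * (Uᴴ * V)ᴴ)).trace := by
    rw [conjTranspose_mul, conjTranspose_conjTranspose]
    simp only [Matrix.mul_assoc]
    rw [trace_mul_comm U]
    simp only [Matrix.mul_assoc]
  rw [e]
  simp only [trace, diag_apply, mul_apply (M := diagonal _ * (Uᴴ * V)), diagonal_mul,
    conjTranspose_apply, star_trivial, Function.comp_apply]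
  exact Finset.sum_congr rfl fun i _ => Finset.sum_congr rfl fun j _ => by ring

/-- Symmetric matrices with `0 ⪯ X ⪯ I`. -/
def spectralBox (n : ℕ) : Set (Matrix (Fin n) (Fin n) ℝ) :=
  {X | X.IsSymm ∧ X.PosSemidef ∧ (1 - X).PosSemidef}

/-- The upper bound holds because 1 - λᵢ is a diagonal entry of Uᴴ(1 - X)U. -/
theorem eigenvalues_mem_Icc (hX : X ∈ spectralBox n) (h : X.IsHermitian) (i : Fin n) :
    0 ≤ h.eigenvalues i ∧ h.eigenvalues i ≤ 1 := by
  refine ⟨hX.2.1.eigenvalues_nonneg i, ?_⟩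
  set U : Matrix (Fin n) (Fin n) ℝ := (h.eigenvectorUnitary).1 with hU
  have hUU : Uᴴ * U = 1 := Unitary.coe_star_mul_self h.eigenvectorUnitary
  have h1 := (hX.2.2.conjTranspose_mul_mul_same U).diag_nonneg (i := i)
  have h2 : Uᴴ * (1 - X) * U = 1 - diagonal h.eigenvalues := by
    have h3 := cfc_eq_conj h (fun x => x)
    rw [cfc_id_of_isSymm hX.1] at h3
    change X = U * diagonal h.eigenvalues * Uᴴ at h3
    rw [Matrix.mul_sub, Matrix.sub_mul, Matrix.mul_one, hUU]
    congr 1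
    calc Uᴴ * X * U = Uᴴ * (U * diagonal h.eigenvalues * Uᴴ) * U := by rw [← h3]
      _ = (Uᴴ * U) * diagonal h.eigenvalues * (Uᴴ * U) := by simp only [Matrix.mul_assoc]
      _ = diagonal h.eigenvalues := by rw [hUU, Matrix.one_mul, Matrix.mul_one]
  rw [h2] at h1
  simpa using h1

theorem posSemidef_cfc (hA : A.IsHermitian) {f : ℝ → ℝ} (hf : ∀ i, 0 ≤ f (hA.eigenvalues i)) :
    (cfc f A).PosSemidef := by
  rw [cfc_eq_conj hA]
  exact (PosSemidef.diagonal hf).mul_mul_conjTranspose_same _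

theorem trace_cfc (hA : A.IsHermitian) (f : ℝ → ℝ) :
    (cfc f A).trace = ∑ i, f (hA.eigenvalues i) := by
  rw [cfc_eq_conj hA, trace_mul_comm, ← Matrix.mul_assoc,
    show (hA.eigenvectorUnitary : Matrix (Fin n) (Fin n) ℝ)ᴴ
      * (hA.eigenvectorUnitary : Matrix (Fin n) (Fin n) ℝ) = 1 from
      Unitary.coe_star_mul_self hA.eigenvectorUnitary, Matrix.one_mul, trace_diagonal]
  rfl

theorem cfc_mem_spectralBox (hA : A.IsSymm) {f : ℝ → ℝ} (hf0 : ∀ x, 0 ≤ f x)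
    (hf1 : ∀ x, f x ≤ 1) : cfc f A ∈ spectralBox n := by
  refine ⟨isSymm_cfc f A, posSemidef_cfc (isHermitian_of_isSymm hA) fun _ => hf0 _, ?_⟩
  rw [← cfc_one_of_isSymm hA, cfc_sub_fun]
  exact posSemidef_cfc (isHermitian_of_isSymm hA) fun _ => sub_nonneg.2 (hf1 _)

theorem trace_cfc_nonneg (hX : X ∈ spectralBox n) {f : ℝ → ℝ}
    (hf : ∀ x, 0 ≤ x → x ≤ 1 → 0 ≤ f x) : 0 ≤ (cfc f X).trace := by
  have h := isHermitian_of_isSymm hX.1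
  rw [trace_cfc h]
  exact Finset.sum_nonneg fun i _ => hf _ (eigenvalues_mem_Icc hX h i).1
    (eigenvalues_mem_Icc hX h i).2

theorem trace_mul_self_eq (hA : A.IsHermitian) :
    (A * A).trace = ∑ i, hA.eigenvalues i * hA.eigenvalues i := by
  rw [← trace_cfc hA fun x => x * x, ← cfc_mul_fun, cfc_id_of_isSymm (isSymm_of_isHermitian hA)]

theorem abs_eigenvalues_le (hA : A.IsHermitian) {δ : ℝ} (hδ : 0 ≤ δ)
    (h : (A * A).trace ≤ δ ^ 2) (i : Fin n) : |hA.eigenvalues i| ≤ δ := by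
  refine abs_le_of_sq_le_sq ?_ hδ
  rw [trace_mul_self_eq hA] at h
  have := Finset.single_le_sum (f := fun i => hA.eigenvalues i * hA.eigenvalues i)
    (fun j _ => mul_self_nonneg _) (Finset.mem_univ i)
  nlinarith

theorem abs_trace_le (hA : A.IsSymm) {δ : ℝ} (hδ : 0 ≤ δ) (h : (A * A).trace ≤ δ ^ 2) :
    |A.trace| ≤ n * δ := by
  have hA' := isHermitian_of_isSymm hA
  have e : A.trace = ∑ i, hA'.eigenvalues i := by
    rw [← trace_cfc hA' fun x => x, cfc_id_of_isSymm hA]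
  rw [e]
  refine (Finset.abs_sum_le_sum_abs _ _).trans ?_
  refine (Finset.sum_le_card_nsmul _ _ δ fun i _ => abs_eigenvalues_le hA' hδ h i).trans ?_
  simp

theorem posSemidef_smul_one_add (hA : A.IsSymm) {c : ℝ} (hc : 0 ≤ c)
    (h : (A * A).trace ≤ c ^ 2) : (c • (1 : Matrix (Fin n) (Fin n) ℝ) + A).PosSemidef := by
  have hA' := isHermitian_of_isSymm hA
  have e : c • (1 : Matrix (Fin n) (Fin n) ℝ) + A = cfc (fun x => c * 1 + x) A := by
    rw [cfc_add A _ _ (continuousOn_spectrum _ _) (continuousOn_spectrum _ _),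
      cfc_const_mul c _ A (continuousOn_spectrum _ _), cfc_one_of_isSymm hA, cfc_id_of_isSymm hA]
  rw [e]
  exact posSemidef_cfc hA' fun i => by
    have := neg_le_of_abs_le (abs_eigenvalues_le hA' hc h i)
    linarith

theorem isSymm_smul_one (c : ℝ) : (c • (1 : Matrix (Fin n) (Fin n) ℝ)).IsSymm :=
  isSymm_one.smul c

/-- Eigenvalues are bounded by the Frobenius norm. This supplies the ball of the Slater condition.
-/
theorem smul_one_add_mem_spectralBox (hA : A.IsSymm) {c δ : ℝ} (hδ : 0 ≤ δ) (h1 : δ ≤ c)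
    (h2 : δ ≤ 1 - c) (h : (A * A).trace ≤ δ ^ 2) :
    c • (1 : Matrix (Fin n) (Fin n) ℝ) + A ∈ spectralBox n := by
  refine ⟨(isSymm_smul_one c).add hA, posSemidef_smul_one_add hA (hδ.trans h1)
    (h.trans (by gcongr)), ?_⟩
  have e : 1 - (c • (1 : Matrix (Fin n) (Fin n) ℝ) + A)
      = (1 - c) • (1 : Matrix (Fin n) (Fin n) ℝ) + -A := by module
  rw [e]
  refine posSemidef_smul_one_add hA.neg (hδ.trans h2) ?_
  rw [neg_mul_neg]
  exact h.trans (by gcongr)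

theorem trace_mul_self_le_trace (hX : X ∈ spectralBox n) : (X * X).trace ≤ X.trace := by
  have h := trace_cfc_nonneg hX (f := fun x => x - x * x) fun x h0 h1 => by nlinarith
  rw [← cfc_sub_fun, ← cfc_mul_fun, cfc_id_of_isSymm hX.1, trace_sub] at h
  linarith

/-- Eigenvalue clipping is the projection onto `spectralBox`. -/
theorem trace_clipEig_le (hA : A.IsSymm) (hX : X ∈ spectralBox n) :
    ((A - clipEig A) * (X - clipEig A)).trace ≤ 0 := by
  obtain ⟨w, hw0, hw⟩ := exists_trace_weights (isHermitian_of_isSymm hA)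
    (isHermitian_of_isSymm hX.1)
  set c : ℝ → ℝ := fun x => min (max x 0) 1 with hc
  have h1 := hw (fun x => x - c x) fun x => x
  have h2 := hw (fun x => (x - c x) * c x) fun _ => 1
  rw [← cfc_sub_fun, cfc_id_of_isSymm hA, cfc_id_of_isSymm hX.1] at h1
  rw [← cfc_mul_fun, ← cfc_sub_fun, cfc_id_of_isSymm hA, cfc_one_of_isSymm hX.1,
    Matrix.mul_one] at h2
  change ((A - cfc c A) * (X - cfc c A)).trace ≤ 0
  rw [Matrix.mul_sub, trace_sub, h1, h2, ← Finset.sum_sub_distrib]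
  refine Finset.sum_nonpos fun i _ => ?_
  rw [← Finset.sum_sub_distrib]
  refine Finset.sum_nonpos fun j _ => ?_
  obtain ⟨hx0, hx1⟩ := eigenvalues_mem_Icc hX (isHermitian_of_isSymm hX.1) j
  generalize (isHermitian_of_isSymm hA).eigenvalues i = a at *
  generalize (isHermitian_of_isSymm hX.1).eigenvalues j = x at *
  -- The scalar projection inequality for [0, 1]; the weights turn it into the matrix one.
  have key : (a - c a) * (x - c a) ≤ 0 := by
    simp only [hc]
    rcases le_total a 0 with h | h
    · rw [max_eq_right h, min_eq_left zero_le_one]; nlinarith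
    · rw [max_eq_left h]
      rcases le_total a 1 with h' | h'
      · rw [min_eq_left h']; simp
      · rw [min_eq_right h']; nlinarith
  nlinarith [mul_nonneg (hw0 i j) (neg_nonneg.2 key)]

/-- The trace form of a pair of differences as a weighted sum over the eigenvalues. -/
theorem exists_trace_sub_weights (hA : A.IsSymm) (hB : B.IsSymm) :
    ∃ (w : Fin n → Fin n → ℝ) (a b : Fin n → ℝ), (∀ i j, 0 ≤ w i j) ∧ ∀ f g : ℝ → ℝ,
      ((cfc f A - cfc f B) * (cfc g A - cfc g B)).trace
        = ∑ i, ∑ j, w i j * ((f (a i) - f (b j)) * (g (a i) - g (b j))) := by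
  obtain ⟨w, hw0, hw⟩ := exists_trace_weights (isHermitian_of_isSymm hA)
    (isHermitian_of_isSymm hB)
  refine ⟨w, (isHermitian_of_isSymm hA).eigenvalues, (isHermitian_of_isSymm hB).eigenvalues, hw0, fun f g => ?_⟩
  have h1 := hw (fun x => f x * g x) fun _ => 1
  have h2 := hw (fun _ => 1) (fun x => f x * g x)
  have h3 := hw f g
  have h4 := hw g f
  rw [← cfc_mul_fun, cfc_one_of_isSymm hB, Matrix.mul_one] at h1
  rw [← cfc_mul_fun, cfc_one_of_isSymm hA, Matrix.one_mul] at h2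
  rw [trace_mul_comm] at h4
  rw [Matrix.sub_mul, Matrix.mul_sub, Matrix.mul_sub, trace_sub, trace_sub, trace_sub, h1, h2, h3,
    h4]
  simp only [← Finset.sum_sub_distrib]
  exact Finset.sum_congr rfl fun i _ => Finset.sum_congr rfl fun j _ => by ring

/-! ### The Fermi-Dirac function -/

theorem fermi_eq_sigmoid (β x : ℝ) : 1 / (1 + Real.exp (β * x)) = Real.sigmoid (-(β * x)) := by
  rw [Real.sigmoid_def, neg_neg, one_div]

/-- The derivative is σ(1 - σ) ≤ 1/4. This is the source of the 4 in β(λ + r) < 4. -/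
theorem abs_sigmoid_sub_le (x y : ℝ) : |Real.sigmoid x - Real.sigmoid y| ≤ 1 / 4 * |x - y| := by
  have := Convex.norm_image_sub_le_of_norm_deriv_le (f := Real.sigmoid) (C := 1 / 4)
    (s := Set.univ) (x := y) (y := x) (fun z _ => differentiableAt_sigmoid) (fun z _ => by
      rw [Real.deriv_sigmoid, Real.norm_eq_abs, abs_of_nonneg
        (mul_nonneg (Real.sigmoid_nonneg z) (sub_nonneg.2 (Real.sigmoid_le_one z)))]
      nlinarith [sq_nonneg (Real.sigmoid z - 1 / 2)]) convex_univ trivial trivial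
  simpa [Real.norm_eq_abs] using this

theorem fermiDirac_mem_spectralBox {β : ℝ} (hY : Y.IsSymm) : fermiDirac β Y ∈ spectralBox n :=
  cfc_mem_spectralBox hY (fun x => by positivity) fun x => by
    rw [fermi_eq_sigmoid]; exact Real.sigmoid_le_one _

theorem trace_fermiDirac_sub_sq_le (β : ℝ) (hA : A.IsSymm) (hB : B.IsSymm) :
    ((fermiDirac β A - fermiDirac β B) * (fermiDirac β A - fermiDirac β B)).trace
      ≤ (β / 4) ^ 2 * ((A - B) * (A - B)).trace := by
  obtain ⟨w, a, b, hw0, hw⟩ := exists_trace_sub_weights hA hB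
  have h1 := hw (fun x => x) fun x => x
  rw [cfc_id_of_isSymm hA, cfc_id_of_isSymm hB] at h1
  rw [fermiDirac, fermiDirac, hw, h1]
  simp only [Finset.mul_sum]
  refine Finset.sum_le_sum fun i _ => Finset.sum_le_sum fun j _ => ?_
  rw [mul_left_comm ((β / 4) ^ 2)]
  refine mul_le_mul_of_nonneg_left ?_ (hw0 i j)
  rw [fermi_eq_sigmoid, fermi_eq_sigmoid]
  have := abs_sigmoid_sub_le (-(β * a i)) (-(β * b j))
  have h2 := mul_self_le_mul_self (abs_nonneg _) this
  rw [abs_mul_abs_self, mul_mul_mul_comm, abs_mul_abs_self] at h2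
  nlinarith

theorem trace_fermiDirac_sub_mul_le {β : ℝ} (hβ : 0 < β) (hA : A.IsSymm) (hB : B.IsSymm) :
    ((fermiDirac β A - fermiDirac β B) * (A - B)).trace ≤ 0 := by
  obtain ⟨w, a, b, hw0, hw⟩ := exists_trace_sub_weights hA hB
  have h1 := hw (fun x => 1 / (1 + Real.exp (β * x))) fun x => x
  rw [cfc_id_of_isSymm hA, cfc_id_of_isSymm hB] at h1
  rw [fermiDirac, fermiDirac, h1]
  refine Finset.sum_nonpos fun i _ => Finset.sum_nonpos fun j _ =>
    mul_nonpos_of_nonneg_of_nonpos (hw0 i j) ?_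
  rw [fermi_eq_sigmoid, fermi_eq_sigmoid]
  rcases le_total (a i) (b j) with h | h
  · refine mul_nonpos_of_nonneg_of_nonpos (sub_nonneg.2 (Real.sigmoid_monotone ?_))
      (sub_nonpos.2 h)
    gcongr
  · refine mul_nonpos_of_nonpos_of_nonneg (sub_nonpos.2 (Real.sigmoid_monotone ?_))
      (sub_nonneg.2 h)
    gcongr

theorem entropy_nonpos {x : ℝ} (h0 : 0 ≤ x) (h1 : x ≤ 1) : entropy x ≤ 0 := by
  have h2 := Real.log_nonpos h0 h1
  have h3 := Real.log_nonpos (sub_nonneg.2 h1) (by linarith)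
  rw [entropy]
  nlinarith

/-- Gibbs' inequality, from log u ≤ u - 1 at u = p / x. The case x = 0 uses 0 ln 0 = 0 and has to be
included, since X may have eigenvalues 0 and 1. -/
theorem mul_log_ge {x p : ℝ} (hx : 0 ≤ x) (hp : 0 < p) :
    x * Real.log p + (x - p) ≤ x * Real.log x := by
  rcases hx.eq_or_lt with rfl | hx
  · simp [hp.le]
  have h := Real.log_le_sub_one_of_pos (div_pos hp hx)
  rw [Real.log_div hp.ne' hx.ne'] at h
  have h2 := mul_le_mul_of_nonneg_left h hx.le
  have h3 : x * (p / x - 1) = p - x := by field_simp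
  linarith

/-- Convexity of the entropy at the Fermi-Dirac occupation number. -/
theorem entropy_fermi_le {t x : ℝ} (h0 : 0 ≤ x) (h1 : x ≤ 1) :
    entropy (1 / (1 + Real.exp t)) ≤ entropy x + t * (x - 1 / (1 + Real.exp t)) := by
  have he := Real.exp_pos t
  set p : ℝ := 1 / (1 + Real.exp t) with hp
  have hp0 : 0 < p := by positivity
  have hp1 : 1 - p = Real.exp t * p := by rw [hp]; field_simp; ring
  -- This says that the derivative of the entropy at p is -t. The claim is the sum of two Gibbs
  -- inequalities, for x against p and for 1 - x against 1 - p.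
  have hlog : Real.log (1 - p) = t + Real.log p := by
    rw [hp1, Real.log_mul he.ne' hp0.ne', Real.log_exp]
  have hq0 : 0 < 1 - p := by rw [hp1]; positivity
  have h2 := mul_log_ge h0 hp0
  have h3 := mul_log_ge (sub_nonneg.2 h1) hq0
  rw [hlog] at h3
  simp only [entropy]
  rw [hlog]
  nlinarith

/-- The subgradient inequality for the entropy at a Fermi-Dirac matrix. -/
theorem trace_entropy_fermiDirac_le {β : ℝ} (hY : Y.IsSymm) (hX : X ∈ spectralBox n) :
    (cfc entropy (fermiDirac β Y)).trace
      ≤ (cfc entropy X).trace + β * (Y * (X - fermiDirac β Y)).trace := by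
  obtain ⟨w, hw0, hw⟩ := exists_trace_weights (isHermitian_of_isSymm hY)
    (isHermitian_of_isSymm hX.1)
  set φ : ℝ → ℝ := fun x => 1 / (1 + Real.exp (β * x)) with hφ
  have hcomp : cfc entropy (fermiDirac β Y) = cfc (fun x => entropy (φ x)) Y := by
    refine (cfc_comp' entropy φ Y ?_ (continuousOn_spectrum _ _)
      (isHermitian_of_isSymm hY)).symm
    exact ((Matrix.finite_real_spectrum (A := Y)).image φ).continuousOn entropy
  have h1 := hw (fun x => entropy (φ x)) fun _ => 1
  have h2 := hw (fun _ => 1) entropy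
  have h3 := hw (fun x => x) (fun x => x)
  have h4 := hw (fun x => x * φ x) (fun _ => 1)
  rw [cfc_one_of_isSymm hX.1, Matrix.mul_one] at h1
  rw [cfc_one_of_isSymm hY, Matrix.one_mul] at h2
  rw [cfc_id_of_isSymm hY, cfc_id_of_isSymm hX.1] at h3
  rw [← cfc_mul_fun, cfc_id_of_isSymm hY, cfc_one_of_isSymm hX.1, Matrix.mul_one] at h4
  change _ ≤ _ + β * (Y * (X - cfc φ Y)).trace
  rw [hcomp, Matrix.mul_sub, trace_sub, h1, h2, h3, h4]
  simp only [← Finset.sum_sub_distrib, Finset.mul_sum, ← Finset.sum_add_distrib]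
  refine Finset.sum_le_sum fun i _ => Finset.sum_le_sum fun j _ => ?_
  obtain ⟨hx0, hx1⟩ := eigenvalues_mem_Icc hX (isHermitian_of_isSymm hX.1) j
  have := mul_le_mul_of_nonneg_left (entropy_fermi_le
    (t := β * (isHermitian_of_isSymm hY).eigenvalues i) hx0 hx1) (hw0 i j)
  simp only [hφ]
  linarith

end LDM

end Spectral

noncomputable section

/-! ### The weighted space of pairs of symmetric matrices -/

namespace LDM

open Matrix

open scoped RealInnerProductSpace

/-- The symmetric matrices as a subspace. -/
def symmSubmodule (n : ℕ) : Submodule ℝ (Matrix (Fin n) (Fin n) ℝ) where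
  carrier := {A | A.IsSymm}
  add_mem' ha hb := IsSymm.add ha hb
  zero_mem' := isSymm_zero
  smul_mem' c _ ha := IsSymm.smul ha c

/-- Pairs of symmetric matrices, to be equipped with the inner product
`lam * tr (A A') + r * tr (B B')`. -/
def WPair (n : ℕ) (_lam _r : ℝ) : Type := symmSubmodule n × symmSubmodule n

namespace WPair

variable {n : ℕ} {lam r : ℝ}

instance : AddCommGroup (WPair n lam r) :=
  inferInstanceAs (AddCommGroup (symmSubmodule n × symmSubmodule n))

instance : Module ℝ (WPair n lam r) :=
  inferInstanceAs (Module ℝ (symmSubmodule n × symmSubmodule n))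

instance : FiniteDimensional ℝ (WPair n lam r) :=
  inferInstanceAs (FiniteDimensional ℝ (symmSubmodule n × symmSubmodule n))

/-- First component. -/
def fst : WPair n lam r →ₗ[ℝ] Matrix (Fin n) (Fin n) ℝ :=
  (symmSubmodule n).subtype ∘ₗ LinearMap.fst ℝ (symmSubmodule n) (symmSubmodule n)

/-- Second component. -/
def snd : WPair n lam r →ₗ[ℝ] Matrix (Fin n) (Fin n) ℝ :=
  (symmSubmodule n).subtype ∘ₗ LinearMap.snd ℝ (symmSubmodule n) (symmSubmodule n)

/-- The pair of two symmetric matrices. -/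
def mk (A B : Matrix (Fin n) (Fin n) ℝ) (hA : A.IsSymm) (hB : B.IsSymm) : WPair n lam r :=
  (⟨A, hA⟩, ⟨B, hB⟩)

theorem isSymm_fst (x : WPair n lam r) : (fst x).IsSymm := x.1.2

theorem isSymm_snd (x : WPair n lam r) : (snd x).IsSymm := x.2.2

@[simp] theorem fst_mk {A B : Matrix (Fin n) (Fin n) ℝ} (hA : A.IsSymm) (hB : B.IsSymm) :
    fst (mk A B hA hB : WPair n lam r) = A := rfl

@[simp] theorem snd_mk {A B : Matrix (Fin n) (Fin n) ℝ} (hA : A.IsSymm) (hB : B.IsSymm) :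
    snd (mk A B hA hB : WPair n lam r) = B := rfl

theorem ext_components {x y : WPair n lam r} (h1 : fst x = fst y) (h2 : snd x = snd y) : x = y :=
  Prod.ext (Subtype.ext h1) (Subtype.ext h2)

end WPair

variable {n : ℕ}

theorem trace_mul_eq_sum {A B : Matrix (Fin n) (Fin n) ℝ} (hB : B.IsSymm) :
    (A * B).trace = ∑ i, ∑ j, A i j * B i j := by
  simp only [trace, diag_apply, mul_apply]
  exact Finset.sum_congr rfl fun i _ => Finset.sum_congr rfl fun j _ => by rw [hB.apply i j]

theorem trace_mul_self_nonneg {A : Matrix (Fin n) (Fin n) ℝ} (hA : A.IsSymm) :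
    0 ≤ (A * A).trace := by
  rw [trace_mul_eq_sum hA]
  exact Finset.sum_nonneg fun i _ => Finset.sum_nonneg fun j _ => mul_self_nonneg _

theorem eq_zero_of_trace_mul_self {A : Matrix (Fin n) (Fin n) ℝ} (hA : A.IsSymm)
    (h : (A * A).trace = 0) : A = 0 := by
  rw [trace_mul_eq_sum hA] at h
  ext i j
  have h1 := (Finset.sum_eq_zero_iff_of_nonneg fun i _ =>
    Finset.sum_nonneg fun j _ => mul_self_nonneg (A i j)).1 h i (Finset.mem_univ i)
  have h2 := (Finset.sum_eq_zero_iff_of_nonneg fun j _ => mul_self_nonneg (A i j)).1 h1 j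
    (Finset.mem_univ j)
  simpa using h2

namespace WPair

variable {lam r : ℝ} [hlam : Fact (0 < lam)] [hr : Fact (0 < r)]

/-- The weighted trace inner product. -/
@[reducible] def core : InnerProductSpace.Core ℝ (WPair n lam r) where
  inner x y := lam * (fst x * fst y).trace + r * (snd x * snd y).trace
  conj_inner_symm x y := by
    simp [trace_mul_comm (fst x), trace_mul_comm (snd x)]
  re_inner_nonneg x := by
    have h1 := mul_nonneg hlam.out.le (trace_mul_self_nonneg x.isSymm_fst)
    have h2 := mul_nonneg hr.out.le (trace_mul_self_nonneg x.isSymm_snd)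
    simpa using add_nonneg h1 h2
  add_left x y z := by simp only [map_add, Matrix.add_mul, trace_add]; ring
  smul_left x y c := by
    simp only [map_smul, Matrix.smul_mul, trace_smul, smul_eq_mul, conj_trivial]; ring
  definite x hx := by
    have h1 := mul_nonneg hlam.out.le (trace_mul_self_nonneg x.isSymm_fst)
    have h2 := mul_nonneg hr.out.le (trace_mul_self_nonneg x.isSymm_snd)
    refine ext_components ?_ ?_
    · rw [map_zero]
      refine eq_zero_of_trace_mul_self x.isSymm_fst ?_
      exact (mul_eq_zero.1 (by linarith)).resolve_left hlam.out.ne'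
    · rw [map_zero]
      refine eq_zero_of_trace_mul_self x.isSymm_snd ?_
      exact (mul_eq_zero.1 (by linarith)).resolve_left hr.out.ne'

instance : NormedAddCommGroup (WPair n lam r) := core.toNormedAddCommGroup

instance : InnerProductSpace ℝ (WPair n lam r) := InnerProductSpace.ofCore core.toCore

theorem inner_def (x y : WPair n lam r) :
    ⟪x, y⟫ = lam * (fst x * fst y).trace + r * (snd x * snd y).trace := rfl

theorem norm_sq_def (x : WPair n lam r) :
    ‖x‖ ^ 2 = lam * (fst x * fst x).trace + r * (snd x * snd x).trace := by
  rw [← real_inner_self_eq_norm_sq, inner_def]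

/-- The norm comes from the weighted trace form, while matrices carry the product topology; finite
dimension reconciles them. -/
theorem continuous_fst : Continuous (fst : WPair n lam r → Matrix (Fin n) (Fin n) ℝ) :=
  LinearMap.continuous_of_finiteDimensional fst

theorem continuous_snd : Continuous (snd : WPair n lam r → Matrix (Fin n) (Fin n) ℝ) :=
  LinearMap.continuous_of_finiteDimensional snd

end WPair

end LDM

end

noncomputable section

/-! ### Convergence of the alternating direction method -/

namespace LDM

open Matrix

open scoped RealInnerProductSpace

variable {n : ℕ}

/-- `P` minimizes `f P + lam / 2 * ‖P - W₁‖² + r / 2 * ‖P - W₂‖²` over `DP`, expressed by the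
variational inequality. -/
structure IsPUpdate (DP : Set (Matrix (Fin n) (Fin n) ℝ)) (f : Matrix (Fin n) (Fin n) ℝ → ℝ)
    (lam r : ℝ) (W₁ W₂ P : Matrix (Fin n) (Fin n) ℝ) : Prop where
  mem : P ∈ DP
  le : ∀ X ∈ DP, f P + (lam * ((W₁ - P) * (X - P)).trace + r * ((W₂ - P) * (X - P)).trace) ≤ f X

/-- `Q` minimizes `η⁻¹ * ‖Q‖₁ + lam / 2 * ‖Q - M‖²` over `DQ`, expressed by the variational
inequality. -/
structure IsQUpdate (DQ : Set (Matrix (Fin n) (Fin n) ℝ)) (η lam : ℝ)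
    (M Q : Matrix (Fin n) (Fin n) ℝ) : Prop where
  mem : Q ∈ DQ
  le : ∀ X ∈ DQ, 1 / η * entrywiseL1 Q + lam * ((M - Q) * (X - Q)).trace ≤ 1 / η * entrywiseL1 X

/-- One step of the alternating direction method. -/
structure IsADMMStep (DP : Set (Matrix (Fin n) (Fin n) ℝ)) (f : Matrix (Fin n) (Fin n) ℝ → ℝ)
    (DQ : Set (Matrix (Fin n) (Fin n) ℝ)) (η lam r : ℝ) (s s' : State n) : Prop where
  P_update : IsPUpdate DP f lam r (s.Q - s.B) (s.R - s.D) s'.P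
  Q_update : IsQUpdate DQ η lam (s'.P + s.B) s'.Q
  R_eq : s'.R = clipEig (s'.P + s.D)
  B_eq : s'.B = s.B + s'.P - s'.Q
  D_eq : s'.D = s.D + s'.P - s'.R

/-- The minimization of `f P + η⁻¹ * ‖P‖₁` over `feasible n N`, split into the constraints
`P ∈ DP`, `P ∈ DQ` and `0 ⪯ P ⪯ I`. -/
structure IsSplitting (N : ℕ) (DP : Set (Matrix (Fin n) (Fin n) ℝ))
    (f : Matrix (Fin n) (Fin n) ℝ → ℝ) (DQ : Set (Matrix (Fin n) (Fin n) ℝ)) (η lam r : ℝ) :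
    Prop where
  isSymm_P : ∀ X ∈ DP, X.IsSymm
  isSymm_Q : ∀ X ∈ DQ, X.IsSymm
  exists_P : ∀ W₁ W₂ : Matrix (Fin n) (Fin n) ℝ, W₁.IsSymm → W₂.IsSymm →
    ∃ P, IsPUpdate DP f lam r W₁ W₂ P
  exists_Q : ∀ M : Matrix (Fin n) (Fin n) ℝ, M.IsSymm → ∃ Q, IsQUpdate DQ η lam M Q
  of_feasible : ∀ X ∈ feasible n N, X ∈ DP ∧ X ∈ DQ
  trace_eq : (∀ X ∈ DP, X.trace = N) ∨ ∀ X ∈ DQ, X.trace = N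
  bounded_below : ∃ C : ℝ, 0 ≤ C ∧ ∀ P ∈ DP, ∀ R ∈ spectralBox n,
    -C - C * √((P - R) * (P - R)).trace ≤ f P
  interior : 0 < n → ∃ C : ℝ, ∀ A : Matrix (Fin n) (Fin n) ℝ, A.IsSymm → ∃ c : ℝ,
    |c - N / n| ≤ |A.trace| / n ∧ c • (1 : Matrix (Fin n) (Fin n) ℝ) + A ∈ DQ ∧
      (0 ≤ c → c ≤ 1 → c • (1 : Matrix (Fin n) (Fin n) ℝ) ∈ DP ∧
        f (c • (1 : Matrix (Fin n) (Fin n) ℝ)) ≤ C)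

/-! ### Bounds for symmetric matrices and the spectral box -/

theorem isSymm_clipEig (A : Matrix (Fin n) (Fin n) ℝ) : (clipEig A).IsSymm := isSymm_cfc _ _

theorem clipEig_mem_spectralBox {A : Matrix (Fin n) (Fin n) ℝ} (hA : A.IsSymm) :
    clipEig A ∈ spectralBox n :=
  cfc_mem_spectralBox hA (fun _ => le_min (le_max_right _ _) zero_le_one) fun _ => min_le_right _ _

theorem trace_le_of_mem_spectralBox {X : Matrix (Fin n) (Fin n) ℝ} (hX : X ∈ spectralBox n) :
    X.trace ≤ n := by
  have := hX.2.2.trace_nonneg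
  rw [trace_sub, trace_one, Fintype.card_fin] at this
  linarith

theorem mem_feasible_iff {N : ℕ} {X : Matrix (Fin n) (Fin n) ℝ} :
    X ∈ feasible n N ↔ X ∈ spectralBox n ∧ X.trace = N := by
  simp only [feasible, spectralBox, Set.mem_ofPred_eq]
  tauto

theorem entrywiseL1_nonneg (X : Matrix (Fin n) (Fin n) ℝ) : 0 ≤ entrywiseL1 X :=
  Finset.sum_nonneg fun _ _ => Finset.sum_nonneg fun _ _ => abs_nonneg _

theorem entrywiseL1_le {X : Matrix (Fin n) (Fin n) ℝ} (hX : X.IsSymm) :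
    entrywiseL1 X ≤ n * n + (X * X).trace := by
  have h : ∀ i j, |X i j| ≤ 1 + X i j * X i j := fun i j => by
    rw [← abs_mul_abs_self]; nlinarith [sq_nonneg (|X i j| - 1), abs_nonneg (X i j)]
  rw [trace_mul_eq_sum hX, entrywiseL1]
  refine (Finset.sum_le_sum fun i _ => Finset.sum_le_sum fun j _ => h i j).trans ?_
  simp [Finset.sum_add_distrib]

theorem trace_add_mul_self_le {X Y : Matrix (Fin n) (Fin n) ℝ} (hX : X.IsSymm) (hY : Y.IsSymm) :
    ((X + Y) * (X + Y)).trace ≤ 2 * (X * X).trace + 2 * (Y * Y).trace := by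
  have := trace_mul_self_nonneg (hX.sub hY)
  simp only [Matrix.add_mul, Matrix.mul_add, Matrix.sub_mul, Matrix.mul_sub, trace_add,
    trace_sub] at *
  linarith

theorem tendsto_zero_of_trace_mul_self {X : ℕ → Matrix (Fin n) (Fin n) ℝ}
    (hX : ∀ k, (X k).IsSymm) (h : Tendsto (fun k => (X k * X k).trace) atTop (𝓝 0)) :
    Tendsto X atTop (𝓝 0) := by
  refine tendsto_pi_nhds.2 fun i => tendsto_pi_nhds.2 fun j => ?_
  have hle : ∀ k, X k i j ^ 2 ≤ (X k * X k).trace := fun k => by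
    rw [trace_mul_eq_sum (hX k), sq]
    exact (Finset.single_le_sum (f := fun j => X k i j * X k i j)
      (fun j _ => mul_self_nonneg _) (Finset.mem_univ j)).trans
      (Finset.single_le_sum (f := fun i => ∑ j, X k i j * X k i j)
        (fun i _ => Finset.sum_nonneg fun j _ => mul_self_nonneg _) (Finset.mem_univ i))
  have h1 := (squeeze_zero (fun k => sq_nonneg _) hle h).sqrt
  simp only [Real.sqrt_sq_eq_abs, Real.sqrt_zero] at h1
  exact (tendsto_zero_iff_abs_tendsto_zero _).2 h1

/-- For `N = 0` or `N = n`, a matrix `0 ⪯ X ⪯ I` with trace close to `N` is close to `(N / n) I`. -/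
theorem trace_sub_smul_one_le {N : ℕ} (hN : N = 0 ∨ N = n) {X : Matrix (Fin n) (Fin n) ℝ}
    (hX : X ∈ spectralBox n) :
    ((X - ((N : ℝ) / n) • (1 : Matrix (Fin n) (Fin n) ℝ))
      * (X - ((N : ℝ) / n) • (1 : Matrix (Fin n) (Fin n) ℝ))).trace ≤ |X.trace - N| := by
  rcases N.eq_zero_or_pos with h0 | hpos
  · subst h0
    simpa using (trace_mul_self_le_trace hX).trans (le_abs_self _)
  · obtain rfl : N = n := hN.resolve_left hpos.ne'
    have hbox : 1 - X ∈ spectralBox N :=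
      ⟨isSymm_one.sub hX.1, hX.2.2, by rw [sub_sub_cancel]; exact hX.2.1⟩
    have h := trace_mul_self_le_trace hbox
    rw [div_self (by positivity), one_smul, ← neg_sub 1 X, neg_mul_neg]
    refine h.trans ?_
    rw [trace_sub, trace_one, Fintype.card_fin, abs_sub_comm]
    exact le_abs_self _

theorem smul_one_mem_feasible {N : ℕ} (hN : N ≤ n) :
    ((N : ℝ) / n) • (1 : Matrix (Fin n) (Fin n) ℝ) ∈ feasible n N := by
  have h0 : (0 : ℝ) ≤ (N : ℝ) / n := by positivity
  have h1 : (N : ℝ) / n ≤ 1 := div_le_one_of_le₀ (by exact_mod_cast hN) (by positivity)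
  rw [mem_feasible_iff]
  constructor
  · have := smul_one_add_mem_spectralBox (A := (0 : Matrix (Fin n) (Fin n) ℝ)) isSymm_zero le_rfl
      h0 (sub_nonneg.2 h1) (by simp)
    rwa [add_zero] at this
  · rw [trace_smul, trace_one, Fintype.card_fin, smul_eq_mul]
    rcases n.eq_zero_or_pos with rfl | hn
    · simp [Nat.le_zero.1 hN]
    · field_simp

theorem IsSplitting.isSymm_step {lam r η : ℝ} {DP DQ : Set (Matrix (Fin n) (Fin n) ℝ)}
    {f : Matrix (Fin n) (Fin n) ℝ → ℝ} {N : ℕ} (h : IsSplitting N DP f DQ η lam r)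
    {s s' : State n} (hs : s.IsSymm) (hstep : IsADMMStep DP f DQ η lam r s s') : s'.IsSymm := by
  have hP := h.isSymm_P _ hstep.P_update.mem
  have hQ := h.isSymm_Q _ hstep.Q_update.mem
  have hR : s'.R.IsSymm := hstep.R_eq ▸ isSymm_clipEig _
  exact ⟨hQ, hR, hstep.B_eq ▸ (hs.2.2.1.add hP).sub hQ, hstep.D_eq ▸ (hs.2.2.2.add hP).sub hR⟩

/-! ### The alternating direction method as a Douglas-Rachford iteration on pairs -/

section Pair

variable {lam r : ℝ} [hlam : Fact (0 < lam)] [hr : Fact (0 < r)]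
  {DP DQ : Set (Matrix (Fin n) (Fin n) ℝ)} {f : Matrix (Fin n) (Fin n) ℝ → ℝ} {η : ℝ} {N : ℕ}

/-- Pairs `(P, P)` with `P ∈ DP`. -/
def diagDomain (lam r : ℝ) (DP : Set (Matrix (Fin n) (Fin n) ℝ)) : Set (WPair n lam r) :=
  {x | WPair.fst x = WPair.snd x ∧ WPair.fst x ∈ DP}

/-- Pairs `(Q, R)` with `Q ∈ DQ` and `0 ⪯ R ⪯ I`. -/
def prodDomain (lam r : ℝ) (DQ : Set (Matrix (Fin n) (Fin n) ℝ)) : Set (WPair n lam r) :=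
  {x | WPair.fst x ∈ DQ ∧ WPair.snd x ∈ spectralBox n}

theorem IsPUpdate.diag_le {W₁ W₂ P : Matrix (Fin n) (Fin n) ℝ}
    (h : IsPUpdate DP f lam r W₁ W₂ P) (hP : P.IsSymm) {w : WPair n lam r}
    (hw₁ : WPair.fst w = W₁) (hw₂ : WPair.snd w = W₂) :
    ∀ x ∈ diagDomain lam r DP, f (WPair.fst (WPair.mk P P hP hP : WPair n lam r))
      + ⟪w - WPair.mk P P hP hP, x - WPair.mk P P hP hP⟫ ≤ f (WPair.fst x) := by
  intro x hx
  have := h.le _ hx.2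
  rw [WPair.inner_def]
  simpa only [map_sub, WPair.fst_mk, WPair.snd_mk, ← hx.1, hw₁, hw₂] using this

theorem IsQUpdate.prod_le {M₁ M₂ Q : Matrix (Fin n) (Fin n) ℝ}
    (h : IsQUpdate DQ η lam M₁ Q) (hQ : Q.IsSymm) (hM₂ : M₂.IsSymm) {w : WPair n lam r}
    (hw₁ : WPair.fst w = M₁) (hw₂ : WPair.snd w = M₂) :
    ∀ x ∈ prodDomain lam r DQ,
      1 / η * entrywiseL1 (WPair.fst (WPair.mk Q (clipEig M₂) hQ (isSymm_clipEig _) : WPair n lam r))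
      + ⟪w - WPair.mk Q (clipEig M₂) hQ (isSymm_clipEig _),
        x - WPair.mk Q (clipEig M₂) hQ (isSymm_clipEig _)⟫ ≤ 1 / η * entrywiseL1 (WPair.fst x) := by
  intro x hx
  have h1 := h.le _ hx.1
  have h2 := mul_nonpos_of_nonneg_of_nonpos hr.out.le (trace_clipEig_le hM₂ hx.2)
  rw [WPair.inner_def]
  simp only [map_sub, WPair.fst_mk, WPair.snd_mk, hw₁, hw₂]
  linarith

/-- The proximal map of `f` on diagonal pairs. -/
def proxP (h : IsSplitting N DP f DQ η lam r) (w : WPair n lam r) : WPair n lam r :=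
  let hP := h.exists_P _ _ w.isSymm_fst w.isSymm_snd
  WPair.mk hP.choose hP.choose (h.isSymm_P _ hP.choose_spec.mem) (h.isSymm_P _ hP.choose_spec.mem)

/-- The proximal map of the weighted `ℓ¹` norm and the spectral constraint. -/
def proxQR (h : IsSplitting N DP f DQ η lam r) (w : WPair n lam r) : WPair n lam r :=
  let hQ := h.exists_Q _ w.isSymm_fst
  WPair.mk hQ.choose (clipEig (WPair.snd w)) (h.isSymm_Q _ hQ.choose_spec.mem) (isSymm_clipEig _)

theorem isProx_proxP (h : IsSplitting N DP f DQ η lam r) :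
    IsProx (diagDomain lam r DP) (fun x => f (WPair.fst x)) (proxP h) where
  mem w := ⟨rfl, (h.exists_P _ _ w.isSymm_fst w.isSymm_snd).choose_spec.mem⟩
  le w := (h.exists_P _ _ w.isSymm_fst w.isSymm_snd).choose_spec.diag_le _ rfl rfl

theorem isProx_proxQR (h : IsSplitting N DP f DQ η lam r) : IsProx (prodDomain lam r DQ)
    (fun x => 1 / η * entrywiseL1 (WPair.fst x)) (proxQR h) where
  mem w := ⟨(h.exists_Q _ w.isSymm_fst).choose_spec.mem, clipEig_mem_spectralBox w.isSymm_snd⟩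
  le w := (h.exists_Q _ w.isSymm_fst).choose_spec.prod_le _ w.isSymm_snd rfl rfl

/-- The proximal maps are built by choice; uniqueness in the variational inequality identifies them
with the updates of the algorithm. -/
theorem mk_eq_proxP (h : IsSplitting N DP f DQ η lam r)
    {P : Matrix (Fin n) (Fin n) ℝ} (hP : P.IsSymm) {w : WPair n lam r}
    (hu : IsPUpdate DP f lam r (WPair.fst w) (WPair.snd w) P) :
    WPair.mk P P hP hP = proxP h w :=
  (isProx_proxP h).eq_of_le ⟨rfl, hu.mem⟩ (hu.diag_le hP rfl rfl)

theorem mk_eq_proxQR (h : IsSplitting N DP f DQ η lam r)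
    {Q : Matrix (Fin n) (Fin n) ℝ} (hQ : Q.IsSymm) {w : WPair n lam r}
    (hu : IsQUpdate DQ η lam (WPair.fst w) Q) :
    WPair.mk Q (clipEig (WPair.snd w)) hQ (isSymm_clipEig _) = proxQR h w :=
  (isProx_proxQR h).eq_of_le ⟨hu.mem, clipEig_mem_spectralBox w.isSymm_snd⟩
    (hu.prod_le hQ w.isSymm_snd rfl rfl)

theorem sqrt_trace_le (x : WPair n lam r) :
    √(WPair.snd x * WPair.snd x).trace ≤ 1 / √r * ‖x‖ := by
  have hr0 := hr.out
  rw [one_div_mul_eq_div, le_div_iff₀ (by positivity), ← Real.sqrt_mul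
    (trace_mul_self_nonneg x.isSymm_snd)]
  refine Real.sqrt_le_iff.2 ⟨norm_nonneg _, ?_⟩
  rw [WPair.norm_sq_def]
  have := mul_nonneg hlam.out.le (trace_mul_self_nonneg x.isSymm_fst)
  linarith

theorem exists_energyBoundedBelow (hη : 0 < η) (h : IsSplitting N DP f DQ η lam r) :
    ∃ C, EnergyBoundedBelow (diagDomain lam r DP) (prodDomain lam r DQ)
      (fun x => f (WPair.fst x)) (fun x => 1 / η * entrywiseL1 (WPair.fst x)) C := by
  obtain ⟨C, hC0, hC⟩ := h.bounded_below
  have hr0 := hr.out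
  refine ⟨C + C * (1 / √r), by positivity, fun q hq p hp => ?_⟩
  have h1 := hC _ hq.2 _ hp.2
  have h2 := sqrt_trace_le (q - p)
  rw [map_sub, ← hq.1] at h2
  have h3 := mul_le_mul_of_nonneg_left h2 hC0
  have h4 : 0 ≤ 1 / η * entrywiseL1 (WPair.fst p) :=
    mul_nonneg (by positivity) (entrywiseL1_nonneg _)
  have h5 : 0 ≤ C * (1 / √r) := by positivity
  have h6 := mul_nonneg hC0 (norm_nonneg (q - p))
  simp only
  nlinarith

theorem EnergyBoundedBelow.mono {E : Type*} [NormedAddCommGroup E] {DF DG : Set E}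
    {F G : E → ℝ} {C C' : ℝ} (h : EnergyBoundedBelow DF DG F G C) (hC : C ≤ C') :
    EnergyBoundedBelow DF DG F G C' := by
  refine ⟨h.1.trans hC, fun q hq p hp => le_trans ?_ (h.2 q hq p hp)⟩
  have := mul_le_mul_of_nonneg_right hC (norm_nonneg (q - p))
  linarith

/-- Only the second component R of p = (Q, R) is bounded a priori. With q = (P, P), the distance of
q to p bounds P - R, and then Q through P. -/
theorem norm_le_of_mem_domains {q p : WPair n lam r} (hq : q ∈ diagDomain lam r DP)
    (hp : p ∈ prodDomain lam r DQ) :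
    ‖p‖ ≤ √((lam + r) * n) + (1 + √(lam + r) * (1 / √r)) * ‖q - p‖ := by
  have hl := hlam.out
  have hr0 := hr.out
  have hdiag : ∀ x : WPair n lam r, WPair.fst x = WPair.snd x →
      ‖x‖ = √((lam + r) * (WPair.snd x * WPair.snd x).trace) := fun x hx => by
    rw [← Real.sqrt_sq (norm_nonneg x), WPair.norm_sq_def, hx]
    congr 1; ring
  set R : WPair n lam r := WPair.mk (WPair.snd p) (WPair.snd p) p.isSymm_snd p.isSymm_snd with hR
  have h1 : ‖R‖ ≤ √((lam + r) * n) := by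
    rw [hdiag R rfl]
    refine Real.sqrt_le_sqrt (mul_le_mul_of_nonneg_left ?_ (by positivity))
    exact (trace_mul_self_le_trace hp.2).trans (trace_le_of_mem_spectralBox hp.2)
  have h2 : ‖q - R‖ ≤ √(lam + r) * (1 / √r) * ‖q - p‖ := by
    rw [hdiag (q - R) (by rw [map_sub, map_sub, hq.1, hR, WPair.fst_mk, WPair.snd_mk]),
      Real.sqrt_mul (by positivity), mul_assoc]
    refine mul_le_mul_of_nonneg_left ?_ (by positivity)
    have := sqrt_trace_le (q - p)
    rwa [map_sub] at this ⊢
  have h3 : ‖p‖ ≤ ‖R‖ + ‖q - R‖ + ‖q - p‖ := by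
    have e : p = R + (q - R) - (q - p) := by abel
    calc ‖p‖ = ‖R + (q - R) - (q - p)‖ := by rw [← e]
      _ ≤ _ := (norm_sub_le _ _).trans (by gcongr; exact norm_add_le _ _)
  linarith

/-- A perturbation w = (A, B) is realized by xF = (cI, cI) and xG = (cI + A, cI + B). The scalar c
may depend on A, because cI + A has to keep trace N when DQ carries the trace constraint. -/
theorem exists_isQualified (hη : 0 < η) (h : IsSplitting N DP f DQ η lam r) (hN0 : 0 < N)
    (hNn : N < n) : ∃ ρ C₀, ∀ C ≥ C₀,
      IsQualified (diagDomain lam r DP) (prodDomain lam r DQ) (fun x => f (WPair.fst x))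
        (fun x => 1 / η * entrywiseL1 (WPair.fst x)) ρ C := by
  have hl := hlam.out
  have hr0 := hr.out
  have hn : 0 < n := hN0.trans hNn
  have hn' : (0 : ℝ) < n := by exact_mod_cast hn
  obtain ⟨K, hK⟩ := h.interior hn
  set t : ℝ := (N : ℝ) / n with ht
  have ht0 : 0 < t := by positivity
  have ht1 : t < 1 := by rw [ht, div_lt_one hn']; exact_mod_cast hNn
  -- Half the distance from N/n to {0, 1}: moving c by at most δ leaves room δ for the spectrum of
  -- B. The radius √(min λ r) δ bounds both Frobenius norms by δ.
  set δ : ℝ := min t (1 - t) / 2 with hδ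
  have hδ0 : 0 < δ := by
    have : 0 < min t (1 - t) := lt_min ht0 (by linarith)
    positivity
  have hδt : 2 * δ ≤ t := by rw [hδ]; linarith [min_le_left t (1 - t)]
  have hδt' : 2 * δ ≤ 1 - t := by rw [hδ]; linarith [min_le_right t (1 - t)]
  set m : ℝ := min lam r with hm
  have hm0 : 0 < m := lt_min hl hr0
  set C₁ : ℝ := √((lam + r) * n)
  set C₂ : ℝ := 1 + √(lam + r) * (1 / √r)
  set C₃ : ℝ := |K| + 1 / η * (n * n + (2 * n + 2 * δ ^ 2))
  have hC₁ : 0 ≤ C₁ := by positivity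
  have hC₂ : 0 ≤ C₂ := by positivity
  have hC₃ : 0 ≤ C₃ := by positivity
  refine ⟨√m * δ, C₁ + C₂ + C₃, fun C hC => ⟨by positivity, by linarith, fun w hw => ?_,
    fun q hq p hp => ?_⟩⟩
  swap
  · have h1 := norm_le_of_mem_domains hq hp
    have h2 : C₂ * ‖q - p‖ ≤ C * ‖q - p‖ :=
      mul_le_mul_of_nonneg_right (by linarith) (norm_nonneg _)
    linarith
  have hw2 : ‖w‖ ^ 2 ≤ m * δ ^ 2 := by
    have := pow_le_pow_left₀ (norm_nonneg w) hw 2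
    rwa [mul_pow, Real.sq_sqrt hm0.le] at this
  rw [WPair.norm_sq_def] at hw2
  have hA0 := trace_mul_self_nonneg w.isSymm_fst
  have hB0 := trace_mul_self_nonneg w.isSymm_snd
  have hA : (WPair.fst w * WPair.fst w).trace ≤ δ ^ 2 := by
    have h1 := mul_le_mul_of_nonneg_right (min_le_left lam r) (sq_nonneg δ)
    have h2 := mul_nonneg hr0.le hB0
    exact le_of_mul_le_mul_left (by linarith) hl
  have hB : (WPair.snd w * WPair.snd w).trace ≤ δ ^ 2 := by
    have h1 := mul_le_mul_of_nonneg_right (min_le_right lam r) (sq_nonneg δ)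
    have h2 := mul_nonneg hl.le hA0
    exact le_of_mul_le_mul_left (by linarith) hr0
  obtain ⟨c, hc, hcQ, hcP⟩ := hK _ w.isSymm_fst
  have hct : |c - t| ≤ δ := by
    refine hc.trans ?_
    rw [div_le_iff₀ hn', mul_comm]
    exact abs_trace_le w.isSymm_fst hδ0.le hA
  rw [abs_le] at hct
  have hc0 : δ ≤ c := by linarith
  have hc1 : δ ≤ 1 - c := by linarith
  obtain ⟨hcP1, hcP2⟩ := hcP (by linarith) (by linarith)
  have hs := isSymm_smul_one (n := n) c
  have htr : (c • (1 : Matrix (Fin n) (Fin n) ℝ) * c • (1 : Matrix (Fin n) (Fin n) ℝ)).trace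
      ≤ n := by
    rw [smul_mul_smul_comm, Matrix.one_mul, trace_smul, trace_one, Fintype.card_fin, smul_eq_mul]
    have : c * c ≤ 1 := by nlinarith
    nlinarith
  refine ⟨WPair.mk _ _ hs hs, ⟨rfl, hcP1⟩, WPair.mk _ _ hs hs + w, ⟨?_, ?_⟩,
    add_sub_cancel_left _ _, ?_, ?_⟩
  · rw [map_add]; exact hcQ
  · rw [map_add]; exact smul_one_add_mem_spectralBox w.isSymm_snd hδ0.le hc0 hc1 hB
  · refine le_trans ?_ (show C₁ ≤ C by linarith)
    refine Real.le_sqrt_of_sq_le ?_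
    rw [WPair.norm_sq_def, WPair.fst_mk, WPair.snd_mk, ← add_mul]
    exact mul_le_mul_of_nonneg_left htr (by positivity)
  · refine le_trans ?_ (show C₃ ≤ C by linarith)
    rw [map_add, WPair.fst_mk]
    refine add_le_add (hcP2.trans (le_abs_self K)) (mul_le_mul_of_nonneg_left ?_ (by positivity))
    refine (entrywiseL1_le (hs.add w.isSymm_fst)).trans ?_
    have := trace_add_mul_self_le hs w.isSymm_fst
    linarith

/-- Convergence of the alternating direction method. -/
theorem IsSplitting.exists_convergesTo (hη : 0 < η) (hN : N ≤ n)
    (h : IsSplitting N DP f DQ η lam r) {s : ℕ → State n} (h0 : (s 0).IsSymm)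
    (hs : ∀ k, IsADMMStep DP f DQ η lam r (s k) (s (k + 1))) :
    ∃ P ∈ feasible n N, (∀ X ∈ feasible n N,
      f P + 1 / η * entrywiseL1 P ≤ f X + 1 / η * entrywiseL1 X) ∧ ConvergesTo s P := by
  have hsymm : ∀ k, (s k).IsSymm := fun k => by
    induction k with
    | zero => exact h0
    | succ k ih => exact h.isSymm_step ih (hs k)
  have hPs : ∀ k, (s (k + 1)).P.IsSymm := fun k => h.isSymm_P _ (hs k).P_update.mem
  -- The multiplier updates turn z into (P + B, P + D) with the previous multipliers. The orbit
  -- starts after the first pass, since arbitrary initial data need not satisfy (Q, R) = `proxQR` z.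
  set z : ℕ → WPair n lam r := fun k => WPair.mk ((s (k + 1)).Q + (s (k + 1)).B)
    ((s (k + 1)).R + (s (k + 1)).D) ((hsymm _).1.add (hsymm _).2.2.1)
    ((hsymm _).2.1.add (hsymm _).2.2.2) with hz
  have hz1 : ∀ k, WPair.fst (z k) = (s (k + 1)).P + (s k).B := fun k => by
    rw [hz, WPair.fst_mk, (hs k).B_eq]; abel
  have hz2 : ∀ k, WPair.snd (z k) = (s (k + 1)).P + (s k).D := fun k => by
    rw [hz, WPair.snd_mk, (hs k).D_eq]; abel
  have hG : ∀ k, proxQR h (z k) = WPair.mk (s (k + 1)).Q (s (k + 1)).R (hsymm _).1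
      (hsymm _).2.1 := by
    intro k
    rw [← mk_eq_proxQR h (hsymm (k + 1)).1 (by rw [hz1]; exact (hs k).Q_update)]
    exact WPair.ext_components rfl
      (show clipEig (WPair.snd (z k)) = (s (k + 1)).R by rw [hz2, (hs k).R_eq])
  have hF : ∀ k, proxP h ((2 : ℝ) • proxQR h (z k) - z k)
      = WPair.mk (s (k + 2)).P (s (k + 2)).P (hPs _) (hPs _) := by
    intro k
    refine (mk_eq_proxP h (hPs (k + 1)) ?_).symm
    -- The reflection 2(Q, R) - z is (Q - B, R - D), exactly what the next P-update reads.
    have e1 : WPair.fst ((2 : ℝ) • proxQR h (z k) - z k) = (s (k + 1)).Q - (s (k + 1)).B := by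
      rw [hG, map_sub, map_smul, WPair.fst_mk, hz, WPair.fst_mk]; module
    have e2 : WPair.snd ((2 : ℝ) • proxQR h (z k) - z k) = (s (k + 1)).R - (s (k + 1)).D := by
      rw [hG, map_sub, map_smul, WPair.snd_mk, hz, WPair.snd_mk]; module
    rw [e1, e2]
    exact (hs (k + 1)).P_update
  have hzT : ∀ k, z (k + 1) = drMap (proxP h) (proxQR h) (z k) := by
    intro k
    refine WPair.ext_components ?_ ?_
    · rw [drMap, hF, hG, map_sub, map_add, hz1]
      change _ = (s (k + 1)).Q + (s (k + 1)).B + (s (k + 2)).P - (s (k + 1)).Q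
      abel
    · rw [drMap, hF, hG, map_sub, map_add, hz2]
      change _ = (s (k + 1)).R + (s (k + 1)).D + (s (k + 2)).P - (s (k + 1)).R
      abel
  obtain ⟨C, hC⟩ := exists_energyBoundedBelow hη h
  have hconv : ∀ P, Tendsto (fun k => (s (k + 2)).P) atTop (𝓝 P) →
      Tendsto (fun k => (s (k + 1)).Q) atTop (𝓝 P) →
      Tendsto (fun k => (s (k + 1)).R) atTop (𝓝 P) → ConvergesTo s P := fun P h1 h2 h3 =>
    ((tendsto_add_atTop_iff_nat (f := fun k => (s k).P) 2).1 h1).prodMk_nhds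
      (((tendsto_add_atTop_iff_nat (f := fun k => (s k).Q) 1).1 h2).prodMk_nhds
        ((tendsto_add_atTop_iff_nat (f := fun k => (s k).R) 1).1 h3))
  by_cases hdeg : N = 0 ∨ N = n
  -- The degenerate case, where only the vanishing of the displacement is available and the
  -- multipliers need not converge.
  · set X₀ : Matrix (Fin n) (Fin n) ℝ := ((N : ℝ) / n) • (1 : Matrix (Fin n) (Fin n) ℝ)
      with hX₀
    have hfeas : X₀ ∈ feasible n N := smul_one_mem_feasible hN
    have hX₀s : X₀.IsSymm := hfeas.1
    have huniq : ∀ X ∈ feasible n N, X = X₀ := fun X hX => by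
      rw [mem_feasible_iff] at hX
      have h1 := trace_sub_smul_one_le hdeg hX.1
      rw [hX.2, sub_self, abs_zero] at h1
      have hsub := hX.1.1.sub hX₀s
      exact sub_eq_zero.1 (eq_zero_of_trace_mul_self hsub
        (le_antisymm h1 (trace_mul_self_nonneg hsub)))
    refine ⟨X₀, hfeas, fun X hX => by rw [huniq X hX], ?_⟩
    have hreg := drMap_asymptotically_regular (isProx_proxP h) (isProx_proxQR h) hC
      (x := WPair.mk X₀ X₀ hX₀s hX₀s) ⟨rfl, (h.of_feasible _ hfeas).1⟩
      ⟨(h.of_feasible _ hfeas).2, (mem_feasible_iff.1 hfeas).1⟩ z hzT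
    simp only [hF] at hreg
    simp only [hG] at hreg
    have hPQ : Tendsto (fun k => (s (k + 2)).P - (s (k + 1)).Q) atTop (𝓝 0) := by
      have := (WPair.continuous_fst.tendsto 0).comp hreg
      simpa only [Function.comp_def, map_sub, WPair.fst_mk, map_zero] using this
    have hPR : Tendsto (fun k => (s (k + 2)).P - (s (k + 1)).R) atTop (𝓝 0) := by
      have := (WPair.continuous_snd.tendsto 0).comp hreg
      simpa only [Function.comp_def, map_sub, WPair.snd_mk, map_zero] using this
    have hcont : Continuous fun X : Matrix (Fin n) (Fin n) ℝ => X.trace :=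
      continuous_id.matrix_trace
    have htr : Tendsto (fun k => (s (k + 1)).R.trace - N) atTop (𝓝 0) := by
      rcases h.trace_eq with ht | ht
      · have := ((hcont.tendsto 0).comp hPR).neg
        simp only [Function.comp_def, trace_zero, neg_zero] at this
        refine this.congr fun k => ?_
        rw [trace_sub, ht _ (hs (k + 1)).P_update.mem]; ring
      · have := ((hcont.tendsto 0).comp hPQ).sub ((hcont.tendsto 0).comp hPR)
        simp only [Function.comp_def, trace_zero, sub_zero] at this
        refine this.congr fun k => ?_
        rw [trace_sub, trace_sub, ht _ (hs k).Q_update.mem]; ring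
    have hbox : ∀ k, (s (k + 1)).R ∈ spectralBox n := fun k => by
      rw [(hs k).R_eq]
      exact clipEig_mem_spectralBox ((hPs k).add (hsymm k).2.2.2)
    have hRX : Tendsto (fun k => (s (k + 1)).R - X₀) atTop (𝓝 0) := by
      refine tendsto_zero_of_trace_mul_self (fun k => (hsymm _).2.1.sub hX₀s) ?_
      refine squeeze_zero (fun k => trace_mul_self_nonneg ((hsymm _).2.1.sub hX₀s))
        (fun k => trace_sub_smul_one_le hdeg (hbox k)) ?_
      simpa using htr.abs
    have hR : Tendsto (fun k => (s (k + 1)).R) atTop (𝓝 X₀) := by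
      simpa using hRX.add_const X₀
    have hP : Tendsto (fun k => (s (k + 2)).P) atTop (𝓝 X₀) := by
      simpa using hPR.add hR
    have hQ : Tendsto (fun k => (s (k + 1)).Q) atTop (𝓝 X₀) := by
      simpa using hP.sub hPQ
    exact hconv X₀ hP hQ hR
  · push Not at hdeg
    obtain ⟨ρ, C₀, hq⟩ := exists_isQualified hη h (Nat.pos_of_ne_zero hdeg.1)
      (lt_of_le_of_ne hN hdeg.2)
    obtain ⟨x, hxF, hxG, hmin, hlimG, hlimF⟩ := exists_drMap_tendsto (isProx_proxP h)
      (isProx_proxQR h) (hC.mono (le_max_left C C₀)) (hq _ (le_max_right C C₀)) z hzT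
    have hfeas : WPair.fst x ∈ feasible n N := by
      rw [mem_feasible_iff]
      refine ⟨hxF.1 ▸ hxG.2, ?_⟩
      rcases h.trace_eq with ht | ht
      · exact ht _ hxF.2
      · exact ht _ hxG.1
    refine ⟨WPair.fst x, hfeas, fun X hX => ?_, hconv _ ?_ ?_ ?_⟩
    · exact hmin (WPair.mk X X hX.1 hX.1) ⟨rfl, (h.of_feasible X hX).1⟩
        ⟨(h.of_feasible X hX).2, (mem_feasible_iff.1 hX).1⟩
    · have := (WPair.continuous_fst.tendsto x).comp hlimF
      simpa only [Function.comp_def, hF, WPair.fst_mk] using this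
    · have := (WPair.continuous_fst.tendsto x).comp hlimG
      simpa only [Function.comp_def, hG, WPair.fst_mk] using this
    · have := (WPair.continuous_snd.tendsto x).comp hlimG
      rw [← hxF.1] at this
      simpa only [Function.comp_def, hG, WPair.snd_mk] using this

end Pair

end LDM

end

noncomputable section

/-! ### The `ℓ¹` updates -/

namespace LDM

open Matrix

variable {n : ℕ}

/-- The residual x - `shrink x t` is a subgradient of t|·| at `shrink x t`. -/
theorem shrink_le {t : ℝ} (ht : 0 ≤ t) (x y : ℝ) :
    t * |shrink x t| + (x - shrink x t) * (y - shrink x t) ≤ t * |y| := by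
  rw [shrink]
  have hy1 := le_abs_self y
  have hy2 := neg_abs_le y
  rcases lt_trichotomy x 0 with hx | rfl | hx
  · rw [Real.sign_of_neg hx, abs_of_neg hx]
    rcases le_total (-x - t) 0 with h | h
    · rw [max_eq_right h]
      simp only [mul_zero, abs_zero, sub_zero, zero_add]
      nlinarith [abs_nonneg y]
    · rw [max_eq_left h, abs_mul, abs_neg, abs_one, abs_of_nonneg h]
      nlinarith
  · simpa using mul_nonneg ht (abs_nonneg y)
  · rw [Real.sign_of_pos hx, abs_of_pos hx]
    rcases le_total (x - t) 0 with h | h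
    · rw [max_eq_right h]
      simp only [mul_zero, abs_zero, sub_zero, zero_add]
      nlinarith [abs_nonneg y]
    · rw [max_eq_left h, one_mul, abs_of_nonneg h]
      nlinarith

theorem weighted_shrink_le {η lam : ℝ} (hη : 0 < η) (hlam : 0 < lam) (x y : ℝ) :
    1 / η * |shrink x (1 / (lam * η))|
      + lam * ((x - shrink x (1 / (lam * η))) * (y - shrink x (1 / (lam * η)))) ≤ 1 / η * |y| := by
  have h := mul_le_mul_of_nonneg_left
    (shrink_le (t := 1 / (lam * η)) (by positivity) x y) hlam.le
  have e : lam * (1 / (lam * η)) = 1 / η := by field_simp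
  rwa [mul_add, ← mul_assoc, ← mul_assoc lam (1 / (lam * η)) |y|, e] at h

theorem isQUpdate_of_sum_nonneg {DQ : Set (Matrix (Fin n) (Fin n) ℝ)} {η lam : ℝ}
    {M Q : Matrix (Fin n) (Fin n) ℝ} (hD : ∀ X ∈ DQ, X.IsSymm) (hQ : Q ∈ DQ)
    (h : ∀ X ∈ DQ, 0 ≤ ∑ i, ∑ j,
      (1 / η * |X i j| - (1 / η * |Q i j| + lam * ((M i j - Q i j) * (X i j - Q i j))))) :
    IsQUpdate DQ η lam M Q := by
  refine ⟨hQ, fun X hX => ?_⟩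
  have h1 := h X hX
  rw [trace_mul_eq_sum ((hD X hX).sub (hD Q hQ))]
  simp only [Finset.sum_sub_distrib, Finset.sum_add_distrib, ← Finset.mul_sum] at h1
  simp only [entrywiseL1, Matrix.sub_apply]
  linarith

theorem isQUpdate_shrink {η lam : ℝ} (hη : 0 < η) (hlam : 0 < lam)
    {M : Matrix (Fin n) (Fin n) ℝ} (hM : M.IsSymm) :
    IsQUpdate {X | X.IsSymm} η lam M (M.map fun x => shrink x (1 / (lam * η))) := by
  refine isQUpdate_of_sum_nonneg (fun X hX => hX) (hM.map _) fun X _ => ?_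
  refine Finset.sum_nonneg fun i _ => Finset.sum_nonneg fun j _ => sub_nonneg.2 ?_
  exact weighted_shrink_le hη hlam (M i j) (X i j)

/-- Minimality is tested along the segment from q to v; after division by the step t, letting t → 0⁺
removes the quadratic remainder. -/
theorem IsDiagUpdate.le {N : ℕ} {η lam : ℝ} (hη : 0 < η) {m q : Fin n → ℝ}
    (h : IsDiagUpdate N η lam m q) {v : Fin n → ℝ} (hv : ∑ i, v i = N) :
    1 / η * ∑ i, |q i| + lam * ∑ i, (m i - q i) * (v i - q i) ≤ 1 / η * ∑ i, |v i| := by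
  have hq : ∑ i, q i = N := h.1
  set a : ℝ := 1 / η * ∑ i, |v i| - 1 / η * ∑ i, |q i| - lam * ∑ i, (m i - q i) * (v i - q i)
    with ha
  set b : ℝ := lam / 2 * ∑ i, (v i - q i) ^ 2 with hb
  have key : ∀ t : ℝ, t ∈ Set.Ioc (0 : ℝ) 1 → 0 ≤ a + t * b := by
    rintro t ⟨ht0, ht1⟩
    have hmin := h.2 (show (fun i => q i + t * (v i - q i)) ∈ {v : Fin n → ℝ | ∑ i, v i = (N : ℝ)} by
      simp [Finset.sum_add_distrib, ← Finset.mul_sum, hq, hv])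
    simp only [Set.mem_ofPred_eq] at hmin
    have h1 : ∑ i, |q i + t * (v i - q i)| ≤ (1 - t) * ∑ i, |q i| + t * ∑ i, |v i| := by
      rw [Finset.mul_sum, Finset.mul_sum, ← Finset.sum_add_distrib]
      refine Finset.sum_le_sum fun i _ => ?_
      have e : q i + t * (v i - q i) = (1 - t) * q i + t * v i := by ring
      rw [e]
      refine (abs_add_le _ _).trans ?_
      rw [abs_mul, abs_mul, abs_of_nonneg (sub_nonneg.2 ht1), abs_of_pos ht0]
    have h2 : ∑ i, (q i + t * (v i - q i) - m i) ^ 2 = ∑ i, (q i - m i) ^ 2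
        - 2 * t * ∑ i, (m i - q i) * (v i - q i) + t ^ 2 * ∑ i, (v i - q i) ^ 2 := by
      rw [Finset.mul_sum, Finset.mul_sum, ← Finset.sum_sub_distrib, ← Finset.sum_add_distrib]
      exact Finset.sum_congr rfl fun i _ => by ring
    rw [h2] at hmin
    have h3 := mul_le_mul_of_nonneg_left h1 (show 0 ≤ 1 / η by positivity)
    have h4 : 0 ≤ t * (a + t * b) := by rw [ha, hb]; linarith
    exact nonneg_of_mul_nonneg_right h4 ht0
  have hlim : Tendsto (fun t : ℝ => a + t * b) (𝓝[>] 0) (𝓝 (a + 0 * b)) := by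
    refine tendsto_nhdsWithin_of_tendsto_nhds ?_
    exact (Continuous.tendsto (by fun_prop) 0)
  rw [zero_mul, add_zero] at hlim
  have h0 : 0 ≤ a := by
    refine ge_of_tendsto hlim ?_
    filter_upwards [Ioc_mem_nhdsGT (zero_lt_one' ℝ)] with t ht using key t ht
  rw [ha] at h0
  linarith

/-- The quadratic term makes the part of the hyperplane below the value at the constant vector N/n
bounded, so a minimizer exists by compactness. -/
theorem exists_isDiagUpdate {N : ℕ} (hN : N ≤ n) {η lam : ℝ} (hη : 0 < η) (hlam : 0 < lam)
    (m : Fin n → ℝ) : ∃ q, IsDiagUpdate N η lam m q := by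
  set φ : (Fin n → ℝ) → ℝ := fun v => 1 / η * ∑ i, |v i| + lam / 2 * ∑ i, (v i - m i) ^ 2 with hφ
  have hφc : Continuous φ := by fun_prop
  set v₀ : Fin n → ℝ := fun _ => (N : ℝ) / n with hv₀
  have hv₀s : ∑ i, v₀ i = (N : ℝ) := by
    rcases n.eq_zero_or_pos with rfl | hn
    · simp [Nat.le_zero.1 hN]
    · simp only [hv₀, Finset.sum_const, Finset.card_univ, Fintype.card_fin, nsmul_eq_mul]
      field_simp
  set c : ℝ := 2 / lam * φ v₀ with hc
  have hle : ∀ v, φ v ≤ φ v₀ → ∑ i, (v i - m i) ^ 2 ≤ c := fun v hv => by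
    have h1 : 0 ≤ 1 / η * ∑ i, |v i| :=
      mul_nonneg (by positivity) (Finset.sum_nonneg fun i _ => abs_nonneg _)
    have h2 : lam / 2 * ∑ i, (v i - m i) ^ 2 ≤ φ v₀ := by
      refine le_trans ?_ hv
      simp only [hφ]; linarith
    have h3 := mul_le_mul_of_nonneg_left h2 (show 0 ≤ 2 / lam by positivity)
    rwa [← mul_assoc, show 2 / lam * (lam / 2) = 1 by field_simp, one_mul] at h3
  set K : Set (Fin n → ℝ) := {v | ∑ i, v i = (N : ℝ)} ∩ {v | ∑ i, (v i - m i) ^ 2 ≤ c} with hK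
  have hKc : IsCompact K := by
    refine Metric.isCompact_of_isClosed_isBounded ?_ ?_
    · exact (isClosed_eq (by fun_prop) (by fun_prop)).inter (isClosed_le (by fun_prop) (by fun_prop))
    · refine (Metric.isBounded_closedBall (x := m) (r := √c)).subset fun v hv => ?_
      rw [Metric.mem_closedBall, dist_pi_le_iff (Real.sqrt_nonneg c)]
      intro i
      rw [Real.dist_eq]
      refine Real.abs_le_sqrt ((Finset.single_le_sum (f := fun i => (v i - m i) ^ 2)
        (fun i _ => sq_nonneg _) (Finset.mem_univ i)).trans hv.2)
  obtain ⟨q, hqK, hq⟩ := hKc.exists_isMinOn ⟨v₀, hv₀s, hle v₀ le_rfl⟩ hφc.continuousOn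
  refine ⟨q, hqK.1, fun v hv => ?_⟩
  by_cases hvK : φ v ≤ φ v₀
  · exact hq ⟨hv, hle v hvK⟩
  · exact (hq (show v₀ ∈ K from ⟨hv₀s, hle v₀ le_rfl⟩)).trans (le_of_not_ge hvK)

/-- The trace constraint only sees the diagonal, so the off-diagonal entries decouple into scalar
shrinkages. -/
theorem isQUpdate_of_isDiagUpdate {N : ℕ} {η lam : ℝ} (hη : 0 < η) (hlam : 0 < lam)
    {M Q : Matrix (Fin n) (Fin n) ℝ} (hM : M.IsSymm)
    (hoff : ∀ i j, i ≠ j → Q i j = shrink (M i j) (lam * η)⁻¹)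
    (hdiag : IsDiagUpdate N η lam M.diag Q.diag) :
    IsQUpdate {X | X.IsSymm ∧ X.trace = N} η lam M Q := by
  refine isQUpdate_of_sum_nonneg (fun X hX => hX.1) ⟨?_, hdiag.1⟩ fun X hX => ?_
  · refine IsSymm.ext fun i j => ?_
    by_cases hij : i = j
    · rw [hij]
    · rw [hoff i j hij, hoff j i (Ne.symm hij), hM.apply]
  · set g : Fin n → Fin n → ℝ := fun i j =>
      1 / η * |X i j| - (1 / η * |Q i j| + lam * ((M i j - Q i j) * (X i j - Q i j))) with hg
    have h1 : ∀ i, g i i ≤ ∑ j, g i j := fun i => by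
      rw [← Finset.add_sum_erase _ _ (Finset.mem_univ i)]
      refine le_add_of_nonneg_right (Finset.sum_nonneg fun j hj => sub_nonneg.2 ?_)
      rw [hoff i j (Finset.ne_of_mem_erase hj).symm, ← one_div]
      exact weighted_shrink_le hη hlam _ _
    have h2 : 0 ≤ ∑ i, g i i := by
      have := hdiag.le hη (v := X.diag) hX.2
      simp only [diag_apply] at this
      simp only [hg, Finset.sum_sub_distrib, Finset.sum_add_distrib, ← Finset.mul_sum]
      linarith
    exact h2.trans (Finset.sum_le_sum fun i _ => h1 i)

theorem exists_diagonal_shrink {N : ℕ} (hN : N ≤ n) {η lam : ℝ} (hη : 0 < η) (hlam : 0 < lam)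
    (M : Matrix (Fin n) (Fin n) ℝ) : ∃ Q : Matrix (Fin n) (Fin n) ℝ,
      (∀ i j, i ≠ j → Q i j = shrink (M i j) (lam * η)⁻¹) ∧
        IsDiagUpdate N η lam M.diag Q.diag := by
  obtain ⟨q, hq⟩ := exists_isDiagUpdate hN hη hlam M.diag
  refine ⟨Matrix.of fun i j => if i = j then q i else shrink (M i j) (lam * η)⁻¹,
    fun i j hij => by simp [hij], ?_⟩
  convert hq using 1
  ext i
  simp

/-! ### Zero temperature -/

theorem abs_trace_mul_le {A B : Matrix (Fin n) (Fin n) ℝ} (hA : A.IsSymm) (hB : B.IsSymm) :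
    |(A * B).trace| ≤ √(A * A).trace * √(B * B).trace := by
  rw [← Real.sqrt_mul (trace_mul_self_nonneg hA)]
  refine Real.abs_le_sqrt ?_
  rw [trace_mul_eq_sum hB, trace_mul_eq_sum hA, trace_mul_eq_sum hB]
  simp only [← Fintype.sum_prod_type', ← sq]
  exact Finset.sum_mul_sq_le_sq_mul_sq _ _ _

theorem abs_trace_mul_le_of_mem_spectralBox {H X : Matrix (Fin n) (Fin n) ℝ} (hH : H.IsSymm)
    (hX : X ∈ spectralBox n) : |(H * X).trace| ≤ √(H * H).trace * √n := by
  refine (abs_trace_mul_le hH hX.1).trans (mul_le_mul_of_nonneg_left ?_ (Real.sqrt_nonneg _))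
  exact Real.sqrt_le_sqrt ((trace_mul_self_le_trace hX).trans (trace_le_of_mem_spectralBox hX))

theorem trace_smul_one (c : ℝ) : (c • (1 : Matrix (Fin n) (Fin n) ℝ)).trace = c * n := by
  rw [trace_smul, trace_one, Fintype.card_fin, smul_eq_mul]

theorem trace_mul_smul_one_le (H : Matrix (Fin n) (Fin n) ℝ) {c : ℝ} (h0 : 0 ≤ c) (h1 : c ≤ 1) :
    (H * c • (1 : Matrix (Fin n) (Fin n) ℝ)).trace ≤ |H.trace| := by
  rw [Matrix.mul_smul, Matrix.mul_one, trace_smul, smul_eq_mul]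
  refine (le_abs_self _).trans ?_
  rw [abs_mul, abs_of_nonneg h0]
  exact mul_le_of_le_one_left (abs_nonneg _) h1

/-- Stationarity: λ(W₁ - P) + r(W₂ - P) is H plus a multiple of I, and I pairs to zero with X - P
because the traces agree. As f is linear, equality holds. -/
theorem isPUpdate_zeroTempP {N : ℕ} (hN : N ≤ n) {H : Matrix (Fin n) (Fin n) ℝ} (hH : H.IsSymm)
    {lam r : ℝ} (hlam : 0 < lam) (hr : 0 < r) {s : State n} (hs : s.IsSymm) :
    IsPUpdate {X | X.IsSymm ∧ X.trace = N} (fun X => (H * X).trace) lam r (s.Q - s.B) (s.R - s.D)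
      (zeroTempP H N lam r s) := by
  obtain ⟨hQ, hR, hB, hD⟩ := hs
  set Γ : Matrix (Fin n) (Fin n) ℝ :=
    (lam / (lam + r)) • (s.Q - s.B) + (r / (lam + r)) • (s.R - s.D) - (1 / (lam + r)) • H with hΓ
  set c : ℝ := (Γ.trace - (N : ℝ)) / (n : ℝ) with hc
  have hP : zeroTempP H N lam r s = Γ - c • (1 : Matrix (Fin n) (Fin n) ℝ) := rfl
  have htr : (Γ - c • (1 : Matrix (Fin n) (Fin n) ℝ)).trace = N := by
    rw [trace_sub, trace_smul_one, hc]
    -- For n = 0 the quotient by n is the default 0, and N ≤ n gives N = 0.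
    rcases n.eq_zero_or_pos with rfl | hn
    · simp [Nat.le_zero.1 hN, trace]
    · field_simp; ring
  have hΓs : Γ.IsSymm := (((hQ.sub hB).smul _).add ((hR.sub hD).smul _)).sub (hH.smul _)
  rw [hP]
  refine ⟨⟨hΓs.sub (isSymm_smul_one c), htr⟩, fun X hX => le_of_eq ?_⟩
  set P : Matrix (Fin n) (Fin n) ℝ := Γ - c • (1 : Matrix (Fin n) (Fin n) ℝ) with hPdef
  have hlr : lam + r ≠ 0 := by positivity
  have e : lam • (s.Q - s.B - P) + r • (s.R - s.D - P)
      = H + ((lam + r) * c) • (1 : Matrix (Fin n) (Fin n) ℝ) := by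
    have e1 : (lam + r) • Γ = lam • (s.Q - s.B) + r • (s.R - s.D) - H := by
      rw [hΓ, smul_sub, smul_add, smul_smul, smul_smul, smul_smul, mul_div_cancel₀ _ hlr,
        mul_div_cancel₀ _ hlr, mul_div_cancel₀ _ hlr, one_smul]
    have e2 : lam • (s.Q - s.B - P) + r • (s.R - s.D - P)
        = (lam • (s.Q - s.B) + r • (s.R - s.D)) - (lam + r) • Γ
          + ((lam + r) * c) • (1 : Matrix (Fin n) (Fin n) ℝ) := by
      rw [hPdef]; module
    rw [e2, e1]; abel
  have e3 : lam * ((s.Q - s.B - P) * (X - P)).trace + r * ((s.R - s.D - P) * (X - P)).trace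
      = ((lam • (s.Q - s.B - P) + r • (s.R - s.D - P)) * (X - P)).trace := by
    rw [Matrix.add_mul, trace_add, Matrix.smul_mul, Matrix.smul_mul, trace_smul, trace_smul,
      smul_eq_mul, smul_eq_mul]
  rw [e3, e, Matrix.add_mul, trace_add, Matrix.smul_mul, Matrix.one_mul, trace_smul, trace_sub X,
    htr, hX.2, sub_self, smul_zero, add_zero, Matrix.mul_sub H X P, trace_sub]
  ring

theorem isSplitting_zeroTemp {N : ℕ} (hN : N ≤ n) {H : Matrix (Fin n) (Fin n) ℝ} (hH : H.IsSymm)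
    {η lam r : ℝ} (hη : 0 < η) (hlam : 0 < lam) (hr : 0 < r) :
    IsSplitting N {X : Matrix (Fin n) (Fin n) ℝ | X.IsSymm ∧ X.trace = N}
      (fun X => (H * X).trace) {X | X.IsSymm} η lam r where
  isSymm_P X hX := hX.1
  isSymm_Q X hX := hX
  exists_P W₁ W₂ h₁ h₂ := by
    have := isPUpdate_zeroTempP hN hH hlam hr (s := ⟨0, W₁, W₂, 0, 0⟩)
      ⟨h₁, h₂, isSymm_zero, isSymm_zero⟩
    simp only [sub_zero] at this
    exact ⟨_, this⟩
  exists_Q M hM := ⟨_, isQUpdate_shrink hη hlam hM⟩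
  of_feasible X hX := ⟨⟨hX.1, hX.2.1⟩, hX.1⟩
  trace_eq := Or.inl fun X hX => hX.2
  bounded_below := by
    -- On the trace hyperplane tr(HP) is unbounded below in general, hence the split tr(HP) = tr(HR)
    -- + tr(H(P - R)) with R in the box.
    refine ⟨√(H * H).trace * √n + √(H * H).trace, by positivity, fun P hP R hR => ?_⟩
    have h1 := neg_le_of_abs_le (abs_trace_mul_le_of_mem_spectralBox hH hR)
    have h2 := neg_le_of_abs_le (abs_trace_mul_le hH (hP.1.sub hR.1))
    rw [Matrix.mul_sub H, trace_sub] at h2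
    have h3 : 0 ≤ √(H * H).trace * √n * √((P - R) * (P - R)).trace := by positivity
    have h4 : 0 ≤ √(H * H).trace := by positivity
    nlinarith
  interior hn := by
    refine ⟨|H.trace|, fun A hA => ⟨(N : ℝ) / n, ?_, (isSymm_smul_one _).add hA, fun h0 h1 =>
      ⟨⟨isSymm_smul_one _, ?_⟩, trace_mul_smul_one_le H h0 h1⟩⟩⟩
    · rw [sub_self, abs_zero]; positivity
    · rw [trace_smul_one]; field_simp

theorem isADMMStep_zeroTempStep {N : ℕ} (hN : N ≤ n) {H : Matrix (Fin n) (Fin n) ℝ}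
    (hH : H.IsSymm) {η lam r : ℝ} (hη : 0 < η) (hlam : 0 < lam) (hr : 0 < r) {s : State n}
    (hs : s.IsSymm) :
    IsADMMStep {X : Matrix (Fin n) (Fin n) ℝ | X.IsSymm ∧ X.trace = N}
      (fun X => (H * X).trace) {X | X.IsSymm} η lam r s (zeroTempStep H N η lam r s) where
  P_update := isPUpdate_zeroTempP hN hH hlam hr hs
  Q_update := isQUpdate_shrink hη hlam
    ((isPUpdate_zeroTempP hN hH hlam hr hs).mem.1.add hs.2.2.1)
  R_eq := rfl
  B_eq := rfl
  D_eq := rfl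

theorem exists_zeroTemp_convergesTo {N : ℕ} (hN : N ≤ n) {H : Matrix (Fin n) (Fin n) ℝ}
    (hH : H.IsSymm) {η lam r : ℝ} (hη : 0 < η) (hlam : 0 < lam) (hr : 0 < r) {s₀ : State n}
    (hs₀ : s₀.IsSymm) : ∃ P, IsZeroTempMinimizer H N η P ∧
      ConvergesTo (fun k => (zeroTempStep H N η lam r)^[k] s₀) P := by
  have : Fact (0 < lam) := ⟨hlam⟩
  have : Fact (0 < r) := ⟨hr⟩
  have hsp := isSplitting_zeroTemp hN hH hη hlam hr
  have hsymm : ∀ k, ((zeroTempStep H N η lam r)^[k] s₀).IsSymm := fun k => by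
    induction k with
    | zero => exact hs₀
    | succ k ih =>
      rw [Function.iterate_succ_apply']
      exact hsp.isSymm_step ih (isADMMStep_zeroTempStep hN hH hη hlam hr ih)
  obtain ⟨P, hP, hmin, hconv⟩ := hsp.exists_convergesTo hη hN
    (s := fun k => (zeroTempStep H N η lam r)^[k] s₀) hs₀ fun k => by
      simp only [Function.iterate_succ_apply']
      exact isADMMStep_zeroTempStep hN hH hη hlam hr (hsymm k)
  exact ⟨P, ⟨hP, fun X hX => hmin X hX⟩, hconv⟩

end LDM

end

noncomputable section

/-! ### Finite temperature -/

namespace LDM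

open Matrix

open scoped RealInnerProductSpace

variable {n : ℕ}

/-- The smooth part of the finite temperature energy. -/
def freeEnergy (H : Matrix (Fin n) (Fin n) ℝ) (β : ℝ) (X : Matrix (Fin n) (Fin n) ℝ) : ℝ :=
  (H * X).trace + 1 / β * (cfc entropy X).trace

/-- The argument `H + lam (Z₁ - W₁) + r (Z₂ - W₂)` of the Fermi-Dirac function. -/
def fockMatrix (H W₁ W₂ : Matrix (Fin n) (Fin n) ℝ) (lam r : ℝ)
    (Z₁ Z₂ : Matrix (Fin n) (Fin n) ℝ) : Matrix (Fin n) (Fin n) ℝ :=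
  H + lam • (Z₁ - W₁) + r • (Z₂ - W₂)

theorem isSymm_fockMatrix {H W₁ W₂ Z₁ Z₂ : Matrix (Fin n) (Fin n) ℝ} (hH : H.IsSymm)
    (h₁ : W₁.IsSymm) (h₂ : W₂.IsSymm) (hZ₁ : Z₁.IsSymm) (hZ₂ : Z₂.IsSymm) (lam r : ℝ) :
    (fockMatrix H W₁ W₂ lam r Z₁ Z₂).IsSymm :=
  (hH.add ((hZ₁.sub h₁).smul _)).add ((hZ₂.sub h₂).smul _)

/-- At a self-consistent P, -βY is a subgradient of the entropy trace, so its subgradient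
inequality, divided by β, is the variational inequality. -/
theorem isPUpdate_of_eq_fermiDirac {H W₁ W₂ P : Matrix (Fin n) (Fin n) ℝ} (hH : H.IsSymm)
    (h₁ : W₁.IsSymm) (h₂ : W₂.IsSymm) (hPs : P.IsSymm) {β lam r : ℝ} (hβ : 0 < β)
    (hP : P = fermiDirac β (fockMatrix H W₁ W₂ lam r P P)) :
    IsPUpdate (spectralBox n) (freeEnergy H β) lam r W₁ W₂ P := by
  have hY := isSymm_fockMatrix hH h₁ h₂ hPs hPs lam r
  refine ⟨hP ▸ fermiDirac_mem_spectralBox hY, fun X hX => ?_⟩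
  have h := trace_entropy_fermiDirac_le (β := β) hY hX
  rw [← hP] at h
  have h' := mul_le_mul_of_nonneg_left h (show 0 ≤ 1 / β by positivity)
  rw [mul_add, ← mul_assoc (1 / β) β, one_div_mul_cancel hβ.ne', one_mul] at h'
  have e : (fockMatrix H W₁ W₂ lam r P P * (X - P)).trace = (H * X).trace - (H * P).trace
      - lam * ((W₁ - P) * (X - P)).trace - r * ((W₂ - P) * (X - P)).trace := by
    rw [fockMatrix, ← neg_sub W₁ P, ← neg_sub W₂ P, Matrix.add_mul, Matrix.add_mul,
      Matrix.smul_mul, Matrix.smul_mul, Matrix.neg_mul, Matrix.neg_mul, trace_add, trace_add,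
      trace_smul, trace_smul, trace_neg, trace_neg, Matrix.mul_sub H, trace_sub, smul_eq_mul,
      smul_eq_mul]
    ring
  rw [e] at h'
  simp only [freeEnergy]
  linarith

/-! ### The self-consistent Fermi-Dirac equation -/

section Pair

variable {lam r : ℝ} {H W₁ W₂ : Matrix (Fin n) (Fin n) ℝ}

/-- The Fermi-Dirac fixed point map on pairs of matrices. -/
def fermiMap (H W₁ W₂ : Matrix (Fin n) (Fin n) ℝ) (β : ℝ) (z : WPair n lam r) : WPair n lam r :=
  WPair.mk (fermiDirac β (fockMatrix H W₁ W₂ lam r (WPair.fst z) (WPair.snd z)))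
    (fermiDirac β (fockMatrix H W₁ W₂ lam r (WPair.fst z) (WPair.snd z)))
    (isSymm_cfc _ _) (isSymm_cfc _ _)

theorem fockMatrix_sub (x y : WPair n lam r) :
    fockMatrix H W₁ W₂ lam r (WPair.fst x) (WPair.snd x)
      - fockMatrix H W₁ W₂ lam r (WPair.fst y) (WPair.snd y)
      = lam • WPair.fst (x - y) + r • WPair.snd (x - y) := by
  rw [fockMatrix, fockMatrix, map_sub, map_sub]
  module

variable [hlam : Fact (0 < lam)] [hr : Fact (0 < r)]

/-- The weights of the inner product are those of Y, so the pairing is tr((φ(Y) - φ(Y'))(Y - Y'))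
with φ decreasing. -/
theorem inner_fermiMap_sub_le (hH : H.IsSymm) (h₁ : W₁.IsSymm) (h₂ : W₂.IsSymm) {β : ℝ}
    (hβ : 0 < β) (x y : WPair n lam r) :
    ⟪fermiMap H W₁ W₂ β x - fermiMap H W₁ W₂ β y, x - y⟫ ≤ 0 := by
  have h := trace_fermiDirac_sub_mul_le hβ
    (isSymm_fockMatrix hH h₁ h₂ x.isSymm_fst x.isSymm_snd lam r)
    (isSymm_fockMatrix hH h₁ h₂ y.isSymm_fst y.isSymm_snd lam r)
  rw [fockMatrix_sub, Matrix.mul_add, Matrix.mul_smul, Matrix.mul_smul, trace_add, trace_smul,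
    trace_smul] at h
  rw [WPair.inner_def]
  exact h

theorem norm_fermiMap_sub_sq_le (hH : H.IsSymm) (h₁ : W₁.IsSymm) (h₂ : W₂.IsSymm) (β : ℝ)
    (x y : WPair n lam r) :
    ‖fermiMap H W₁ W₂ β x - fermiMap H W₁ W₂ β y‖ ^ 2
      ≤ (β * (lam + r) / 4) ^ 2 * ‖x - y‖ ^ 2 := by
  have hl := hlam.out
  have hr0 := hr.out
  have h := trace_fermiDirac_sub_sq_le β
    (isSymm_fockMatrix hH h₁ h₂ x.isSymm_fst x.isSymm_snd lam r)
    (isSymm_fockMatrix hH h₁ h₂ y.isSymm_fst y.isSymm_snd lam r)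
  rw [fockMatrix_sub] at h
  have e : ‖fermiMap H W₁ W₂ β x - fermiMap H W₁ W₂ β y‖ ^ 2 = (lam + r)
      * ((fermiDirac β (fockMatrix H W₁ W₂ lam r (WPair.fst x) (WPair.snd x))
        - fermiDirac β (fockMatrix H W₁ W₂ lam r (WPair.fst y) (WPair.snd y)))
        * (fermiDirac β (fockMatrix H W₁ W₂ lam r (WPair.fst x) (WPair.snd x))
        - fermiDirac β (fockMatrix H W₁ W₂ lam r (WPair.fst y) (WPair.snd y)))).trace := by
    rw [WPair.norm_sq_def, map_sub, map_sub, add_mul]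
    rfl
  set d := x - y
  -- Convexity of the square: the two sides differ by λr‖a - b‖² for the components a, b of d.
  have h3 : ((lam • WPair.fst d + r • WPair.snd d) * (lam • WPair.fst d + r • WPair.snd d)).trace
      ≤ (lam + r) * ‖d‖ ^ 2 := by
    have h4 := mul_nonneg (mul_nonneg hl.le hr0.le)
      (trace_mul_self_nonneg (d.isSymm_fst.sub d.isSymm_snd))
    rw [WPair.norm_sq_def]
    simp only [Matrix.add_mul, Matrix.mul_add, Matrix.sub_mul, Matrix.mul_sub, Matrix.smul_mul,
      Matrix.mul_smul, trace_add, trace_sub, trace_smul, smul_eq_mul] at *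
    linarith
  rw [e]
  have h5 := mul_le_mul_of_nonneg_left (h.trans (mul_le_mul_of_nonneg_left h3 (sq_nonneg (β / 4))))
    (show 0 ≤ lam + r by positivity)
  refine h5.trans (le_of_eq ?_)
  ring

end Pair

/-- No smallness of β enters, unlike for the inner loop: the proximal map must exist for every β.
Both components of `fermiMap` agree, so its fixed points are diagonal. -/
theorem exists_eq_fermiDirac {H W₁ W₂ : Matrix (Fin n) (Fin n) ℝ} (hH : H.IsSymm)
    (h₁ : W₁.IsSymm) (h₂ : W₂.IsSymm) {β lam r : ℝ} (hβ : 0 < β) (hlam : 0 < lam) (hr : 0 < r) :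
    ∃ P : Matrix (Fin n) (Fin n) ℝ, P.IsSymm ∧
      P = fermiDirac β (fockMatrix H W₁ W₂ lam r P P) := by
  have : Fact (0 < lam) := ⟨hlam⟩
  have : Fact (0 < r) := ⟨hr⟩
  have : CompleteSpace (WPair n lam r) := FiniteDimensional.complete ℝ _
  obtain ⟨z, hz⟩ := exists_fixed_of_antitone
    (fun x y : WPair n lam r => inner_fermiMap_sub_le hH h₁ h₂ hβ x y)
    (norm_fermiMap_sub_sq_le hH h₁ h₂ β)
  have e1 : WPair.fst z = fermiDirac β (fockMatrix H W₁ W₂ lam r (WPair.fst z) (WPair.snd z)) :=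
    (congrArg WPair.fst hz).symm
  have e2 : WPair.snd z = fermiDirac β (fockMatrix H W₁ W₂ lam r (WPair.fst z) (WPair.snd z)) :=
    (congrArg WPair.snd hz).symm
  have e3 : WPair.snd z = WPair.fst z := e2.trans e1.symm
  rw [e3] at e1
  exact ⟨WPair.fst z, z.isSymm_fst, e1⟩

theorem innerIter_succ (H : Matrix (Fin n) (Fin n) ℝ) (β lam r : ℝ) (s : State n)
    (Z₀ : Matrix (Fin n) (Fin n) ℝ) (l : ℕ) :
    innerIter H β lam r s Z₀ (l + 1) = fermiDirac β (fockMatrix H (s.Q - s.B) (s.R - s.D) lam r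
      (innerIter H β lam r s Z₀ l) (innerIter H β lam r s Z₀ l)) := by
  rw [innerIter, fockMatrix, sub_sub_eq_add_sub, sub_sub_eq_add_sub, add_sub_right_comm,
    add_sub_right_comm]

theorem isSymm_innerIter (H : Matrix (Fin n) (Fin n) ℝ) (β lam r : ℝ) (s : State n)
    {Z₀ : Matrix (Fin n) (Fin n) ℝ} (hZ₀ : Z₀.IsSymm) (l : ℕ) :
    (innerIter H β lam r s Z₀ l).IsSymm := by
  cases l with
  | zero => exact hZ₀
  | succ l => exact isSymm_cfc _ _

theorem isSymm_of_tendsto {X : ℕ → Matrix (Fin n) (Fin n) ℝ} (hX : ∀ k, (X k).IsSymm)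
    {Y : Matrix (Fin n) (Fin n) ℝ} (h : Tendsto X atTop (𝓝 Y)) : Y.IsSymm := by
  have h1 : Tendsto (fun k => (X k)ᵀ) atTop (𝓝 Yᵀ) :=
    (continuous_id.matrix_transpose.tendsto Y).comp h
  simp only [fun k => (hX k).eq] at h1
  exact tendsto_nhds_unique h1 h

/-- Continuity comes from the Lipschitz bound in Frobenius norm. -/
theorem tendsto_fermiDirac {X : ℕ → Matrix (Fin n) (Fin n) ℝ} (hX : ∀ k, (X k).IsSymm)
    {Y : Matrix (Fin n) (Fin n) ℝ} (h : Tendsto X atTop (𝓝 Y)) (β : ℝ) :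
    Tendsto (fun k => fermiDirac β (X k)) atTop (𝓝 (fermiDirac β Y)) := by
  have hY := isSymm_of_tendsto hX h
  have hs : ∀ k, (fermiDirac β (X k) - fermiDirac β Y).IsSymm := fun k =>
    (isSymm_cfc _ _).sub (isSymm_cfc _ _)
  have h1 : Tendsto (fun k => (β / 4) ^ 2 * ((X k - Y) * (X k - Y)).trace) atTop (𝓝 0) := by
    have hc : Continuous fun Z : Matrix (Fin n) (Fin n) ℝ =>
        (β / 4) ^ 2 * ((Z - Y) * (Z - Y)).trace := by fun_prop
    simpa [Function.comp_def] using (hc.tendsto Y).comp h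
  have h2 := tendsto_zero_of_trace_mul_self hs (squeeze_zero
    (fun k => trace_mul_self_nonneg (hs k))
    (fun k => trace_fermiDirac_sub_sq_le β (hX k) hY) h1)
  simpa using h2.add_const (fermiDirac β Y)

theorem eq_fermiDirac_of_tendsto_innerIter {H P Z₀ : Matrix (Fin n) (Fin n) ℝ} (hH : H.IsSymm)
    {β lam r : ℝ} {s : State n} (hs : s.IsSymm) (hZ₀ : Z₀.IsSymm)
    (h : Tendsto (innerIter H β lam r s Z₀) atTop (𝓝 P)) :
    P = fermiDirac β (fockMatrix H (s.Q - s.B) (s.R - s.D) lam r P P) := by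
  have hZ := isSymm_innerIter H β lam r s hZ₀
  have h1 := h.comp (tendsto_add_atTop_nat 1)
  simp only [Function.comp_def, innerIter_succ] at h1
  refine tendsto_nhds_unique h1 (tendsto_fermiDirac (fun l => isSymm_fockMatrix hH
    (hs.1.sub hs.2.2.1) (hs.2.1.sub hs.2.2.2) (hZ l) (hZ l) lam r) ?_ β)
  have hc : Continuous fun Z : Matrix (Fin n) (Fin n) ℝ =>
      fockMatrix H (s.Q - s.B) (s.R - s.D) lam r Z Z := by
    unfold fockMatrix; fun_prop
  exact (hc.tendsto P).comp h

/-- The inner iteration converges if `β (lam + r) < 4`. -/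
theorem exists_tendsto_innerIter {H Z₀ : Matrix (Fin n) (Fin n) ℝ} (hH : H.IsSymm)
    {β lam r : ℝ} (hβ : 0 < β) (hlam : 0 < lam) (hr : 0 < r) (hlt : β * (lam + r) < 4)
    {s : State n} (hs : s.IsSymm) (hZ₀ : Z₀.IsSymm) :
    ∃ P, Tendsto (innerIter H β lam r s Z₀) atTop (𝓝 P) := by
  have : Fact (0 < lam) := ⟨hlam⟩
  have : Fact (0 < r) := ⟨hr⟩
  have : CompleteSpace (WPair n lam r) := FiniteDimensional.complete ℝ _
  have h0 : 0 ≤ β * (lam + r) / 4 := by positivity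
  obtain ⟨z, -, hz⟩ := exists_fixed_of_contraction
    (Φ := (fermiMap H (s.Q - s.B) (s.R - s.D) β : WPair n lam r → WPair n lam r)) h0
    (by linarith) fun x y => by
      refine le_of_sq_le_sq ?_ (by positivity)
      rw [mul_pow]
      exact norm_fermiMap_sub_sq_le hH (hs.1.sub hs.2.2.1) (hs.2.1.sub hs.2.2.2) β x y
  have hiter : ∀ l, (fermiMap H (s.Q - s.B) (s.R - s.D) β)^[l]
      (WPair.mk Z₀ Z₀ hZ₀ hZ₀ : WPair n lam r)
      = WPair.mk (innerIter H β lam r s Z₀ l) (innerIter H β lam r s Z₀ l)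
        (isSymm_innerIter H β lam r s hZ₀ l) (isSymm_innerIter H β lam r s hZ₀ l) := by
    intro l
    induction l with
    | zero => rfl
    | succ l ih =>
      rw [Function.iterate_succ_apply', ih]
      exact WPair.ext_components (innerIter_succ H β lam r s Z₀ l).symm
        (innerIter_succ H β lam r s Z₀ l).symm
  refine ⟨WPair.fst z, ?_⟩
  have := (WPair.continuous_fst.tendsto z).comp (hz (WPair.mk Z₀ Z₀ hZ₀ hZ₀))
  simpa only [Function.comp_def, hiter, WPair.fst_mk] using this

theorem isSplitting_finiteTemp {N : ℕ} (hN : N ≤ n) {H : Matrix (Fin n) (Fin n) ℝ}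
    (hH : H.IsSymm) {β η lam r : ℝ} (hβ : 0 < β) (hη : 0 < η) (hlam : 0 < lam) (hr : 0 < r) :
    IsSplitting N (spectralBox n) (freeEnergy H β)
      {X : Matrix (Fin n) (Fin n) ℝ | X.IsSymm ∧ X.trace = N} η lam r where
  isSymm_P X hX := hX.1
  isSymm_Q X hX := hX.1
  exists_P W₁ W₂ h₁ h₂ := by
    obtain ⟨P, hPs, hP⟩ := exists_eq_fermiDirac hH h₁ h₂ hβ hlam hr
    exact ⟨P, isPUpdate_of_eq_fermiDirac hH h₁ h₂ hPs hβ hP⟩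
  exists_Q M hM := by
    obtain ⟨Q, hoff, hdiag⟩ := exists_diagonal_shrink hN hη hlam M
    exact ⟨Q, isQUpdate_of_isDiagUpdate hη hlam hM hoff hdiag⟩
  of_feasible X hX := ⟨(mem_feasible_iff.1 hX).1, hX.1, hX.2.1⟩
  trace_eq := Or.inr fun X hX => hX.2
  bounded_below := by
    -- The subgradient inequality at Y = 0 shows that I/2 minimizes the entropy trace over the box.
    set e₀ : ℝ := 1 / β * (cfc entropy (fermiDirac β (0 : Matrix (Fin n) (Fin n) ℝ))).trace
      with he₀
    refine ⟨√(H * H).trace * √n + |e₀|, by positivity, fun P hP R _ => ?_⟩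
    have h1 := neg_le_of_abs_le (abs_trace_mul_le_of_mem_spectralBox hH hP)
    have h2 := trace_entropy_fermiDirac_le (β := β) (Y := 0) isSymm_zero hP
    rw [Matrix.zero_mul, trace_zero, mul_zero, add_zero] at h2
    have h3 := mul_le_mul_of_nonneg_left h2 (show 0 ≤ 1 / β by positivity)
    have h4 := neg_abs_le e₀
    have h5 : 0 ≤ (√(H * H).trace * √n + |e₀|) * √((P - R) * (P - R)).trace := by positivity
    simp only [freeEnergy]
    linarith
  interior hn := by
    -- Here DQ fixes the trace, so c is lowered by tr A / n to compensate for A.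
    refine ⟨|H.trace|, fun A hA => ⟨(N : ℝ) / n - A.trace / n, ?_,
      ⟨(isSymm_smul_one _).add hA, ?_⟩, fun h0 h1 => ?_⟩⟩
    · rw [sub_sub_cancel_left, abs_neg, abs_div, Nat.abs_cast]
    · rw [trace_add, trace_smul_one]; field_simp; ring
    · have hbox := smul_one_add_mem_spectralBox (A := (0 : Matrix (Fin n) (Fin n) ℝ)) isSymm_zero
        le_rfl h0 (sub_nonneg.2 h1) (by simp)
      rw [add_zero] at hbox
      refine ⟨hbox, ?_⟩
      have h2 := trace_mul_smul_one_le H h0 h1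
      have h3 := trace_cfc_nonneg hbox (f := fun x => -entropy x) fun x hx0 hx1 =>
        neg_nonneg.2 (entropy_nonpos hx0 hx1)
      rw [cfc_neg, trace_neg] at h3
      have h4 := mul_nonneg (show 0 ≤ 1 / β by positivity) h3
      simp only [freeEnergy]
      linarith

theorem IsFiniteTempStep.isADMMStep {N : ℕ} {H Z₀ : Matrix (Fin n) (Fin n) ℝ} (hH : H.IsSymm)
    {β η lam r : ℝ} (hβ : 0 < β) (hη : 0 < η) (hlam : 0 < lam) (hZ₀ : Z₀.IsSymm)
    {s s' : State n} (hs : s.IsSymm) (h : IsFiniteTempStep H N β η lam r Z₀ s s') :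
    IsADMMStep (spectralBox n) (freeEnergy H β)
      {X : Matrix (Fin n) (Fin n) ℝ | X.IsSymm ∧ X.trace = N} η lam r s s' := by
  have hP : s'.P.IsSymm := isSymm_of_tendsto (isSymm_innerIter H β lam r s hZ₀) h.P_eq
  exact
    { P_update := isPUpdate_of_eq_fermiDirac hH (hs.1.sub hs.2.2.1) (hs.2.1.sub hs.2.2.2) hP hβ
        (eq_fermiDirac_of_tendsto_innerIter hH hs hZ₀ h.P_eq)
      Q_update := isQUpdate_of_isDiagUpdate hη hlam (hP.add hs.2.2.1) h.Q_offDiag h.Q_diag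
      R_eq := h.R_eq
      B_eq := h.B_eq
      D_eq := h.D_eq }

theorem exists_finiteTempStep {N : ℕ} (hN : N ≤ n) {H Z₀ : Matrix (Fin n) (Fin n) ℝ}
    (hH : H.IsSymm) {β η lam r : ℝ} (hβ : 0 < β) (hη : 0 < η) (hlam : 0 < lam) (hr : 0 < r)
    (hlt : β * (lam + r) < 4) (hZ₀ : Z₀.IsSymm) {s : State n} (hs : s.IsSymm) :
    ∃ s' : State n, s'.IsSymm ∧ IsFiniteTempStep H N β η lam r Z₀ s s' := by
  obtain ⟨P, hP⟩ := exists_tendsto_innerIter hH hβ hlam hr hlt hs hZ₀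
  obtain ⟨Q, hoff, hdiag⟩ := exists_diagonal_shrink hN hη hlam (P + s.B)
  have hstep : IsFiniteTempStep H N β η lam r Z₀ s
      ⟨P, Q, clipEig (P + s.D), s.B + P - Q, s.D + P - clipEig (P + s.D)⟩ :=
    ⟨hP, hoff, hdiag, rfl, rfl, rfl⟩
  exact ⟨_, (isSplitting_finiteTemp hN hH hβ hη hlam hr).isSymm_step hs
    (hstep.isADMMStep hH hβ hη hlam hZ₀ hs), hstep⟩

theorem exists_finiteTempRun {N : ℕ} (hN : N ≤ n) {H : Matrix (Fin n) (Fin n) ℝ}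
    (hH : H.IsSymm) {β η lam r : ℝ} (hβ : 0 < β) (hη : 0 < η) (hlam : 0 < lam) (hr : 0 < r)
    (hlt : β * (lam + r) < 4) {Z₀ : ℕ → Matrix (Fin n) (Fin n) ℝ} (hZ₀ : ∀ k, (Z₀ k).IsSymm)
    {s₀ : State n} (hs₀ : s₀.IsSymm) : ∃ s, s 0 = s₀ ∧ IsFiniteTempRun H N β η lam r Z₀ s := by
  -- The recursion runs on symmetric states, since the existence of a pass requires symmetry.
  choose g hg using fun (k : ℕ) (s : {s : State n // s.IsSymm}) =>
    exists_finiteTempStep hN hH hβ hη hlam hr hlt (hZ₀ k) s.2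
  let t : ℕ → {s : State n // s.IsSymm} :=
    fun k => Nat.rec ⟨s₀, hs₀⟩ (fun k s => ⟨g k s, (hg k s).1⟩) k
  exact ⟨fun k => (t k).1, rfl, fun k => (hg k (t k)).2⟩

theorem exists_finiteTemp_convergesTo {N : ℕ} (hN : N ≤ n) {H : Matrix (Fin n) (Fin n) ℝ}
    (hH : H.IsSymm) {β η lam r : ℝ} (hβ : 0 < β) (hη : 0 < η) (hlam : 0 < lam) (hr : 0 < r)
    {Z₀ : ℕ → Matrix (Fin n) (Fin n) ℝ} (hZ₀ : ∀ k, (Z₀ k).IsSymm) {s : ℕ → State n}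
    (hs₀ : (s 0).IsSymm) (hs : IsFiniteTempRun H N β η lam r Z₀ s) :
    ∃ P, IsFiniteTempMinimizer H N β η P ∧ ConvergesTo s P := by
  have : Fact (0 < lam) := ⟨hlam⟩
  have : Fact (0 < r) := ⟨hr⟩
  have hsp := isSplitting_finiteTemp hN hH hβ hη hlam hr
  have hsymm : ∀ k, (s k).IsSymm := fun k => by
    induction k with
    | zero => exact hs₀
    | succ k ih => exact hsp.isSymm_step ih ((hs k).isADMMStep hH hβ hη hlam (hZ₀ k) ih)
  obtain ⟨P, hP, hmin, hconv⟩ := hsp.exists_convergesTo hη hN hs₀ fun k =>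
    (hs k).isADMMStep hH hβ hη hlam (hZ₀ k) (hsymm k)
  exact ⟨P, ⟨hP, fun X hX => hmin X hX⟩, hconv⟩

end LDM

end

theorem theorem3 {n : ℕ} (N : ℕ) (hN : N ≤ n) (H : Matrix (Fin n) (Fin n) ℝ) (hH : H.IsSymm)
    (η lam r : ℝ) (hη : 0 < η) (hlam : 0 < lam) (hr : 0 < r)
    (s₀ : LDM.State n) (hs₀ : s₀.IsSymm) :
    (∃ Pstar, LDM.IsZeroTempMinimizer H N η Pstar ∧
      LDM.ConvergesTo (fun k => (LDM.zeroTempStep H N η lam r)^[k] s₀) Pstar) ∧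
    (∀ β : ℝ, 0 < β →
      ∀ Z₀ : ℕ → Matrix (Fin n) (Fin n) ℝ, (∀ k, (Z₀ k).IsSymm) →
        (β * (lam + r) < 4 → ∃ s, s 0 = s₀ ∧ LDM.IsFiniteTempRun H N β η lam r Z₀ s) ∧
        (∀ s, s 0 = s₀ → LDM.IsFiniteTempRun H N β η lam r Z₀ s →
          ∃ Pstar, LDM.IsFiniteTempMinimizer H N β η Pstar ∧ LDM.ConvergesTo s Pstar)) := by
  refine ⟨LDM.exists_zeroTemp_convergesTo hN hH hη hlam hr hs₀, fun β hβ Z₀ hZ₀ => ⟨fun hlt =>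
    LDM.exists_finiteTempRun hN hH hβ hη hlam hr hlt hZ₀ hs₀, fun s hs hrun => ?_⟩⟩
  exact LDM.exists_finiteTemp_convergesTo hN hH hβ hη hlam hr hZ₀ (hs ▸ hs₀) hrun
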